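/- **Conventions.** Fix the scalar field ($\mathbb R$ or $\mathbb C$), one of the two settings "Banach" or "Fréchet", and $k\in\{0,1,2,\dots,\infty,\omega\}$. A *linear space* $C$ is a locally arcwise connected subspace, with non-void interior, of a Banach (resp. Fréchet) space. A map between subspaces of such spaces is $C^k$ if it is continuous and, when $k\ne 0$, it extends near each point of its domain to a $C^k$ map on an open set of the ambient space (Fréchet-differentiability in the Banach setting; Michal–Bastiani $C^k$ in the Fréchet setting, where $C^\omega$ means $C^\infty$ and, for real scalars, locally extendable to a complex analytic map of the complexifications). A *model space* $(S,\mathcal S)$ is a topological space $S$ with a category $\mathcal S$ whose objects (*model neighborhoods*) are open sets that cover $S$ and are closed under finite intersections, whose morphisms are continuous functions, and which satisfies: restrictions $A'\to B'$ of morphisms $A\to B$ ($A'\subseteq A$, $B'\subseteq B$ model neighborhoods) and inclusions are morphisms; if morphisms $f_\alpha:U_\alpha\to V_\alpha$ agree with a continuous $f:\bigcup U_\alpha\to\bigcup V_\alpha$ between model neighborhoods, then $f$ is a morphism. A *model function* is a continuous function for which inverse images of model neighborhoods are model neighborhoods and images of model neighborhoods lie in model neighborhoods. A *model category* is a category of model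 spaces and model functions, with composition of functions. A $C^k$ *linear model category* is a model category whose objects are model spaces on linear spaces all of whose morphisms are $C^k$, and whose morphisms are $C^k$ model functions. $\mathrm{Triv}\,E$ is the model space of all open sets of $E$ and all continuous functions between them; $\mathrm{Triv}_{C^k}\,C$ is that of all open sets of $C$ and all $C^k$ functions between them. For a set $\mathbf E$ of topological spaces and a set $\mathbf C$ of linear spaces, $\mathrm{Trivcat}\,\mathbf E$ (resp. $\mathrm{Trivcat}_{C^k}\mathbf C$) is the category of the spaces $\mathrm{Triv}\,E$, $E\in\mathbf E$ (resp. $\mathrm{Triv}_{C^k}C$, $C\in\mathbf C$) and all continuous (resp. $C^k$) functions. The minimal model space $\mathrm{Mod}_{\min}(O,F)$ has underlying space $\bigcup O$ and the smallest category that contains the open sets $O$ and the functions $F$ and satisfies the conditions on a model space. The singleton category $\mathrm{sing}(M)$ has the one object $M$ and as morphisms the model functions $M\to M$ that are locally morphisms of the category of $M$; $\mathrm{sing}_{C^k}(M)$ has as morphisms all $C^k$ model functions $M\to M$. A *chart* $(U,V,\phi)$ of $E$ in $C$ is a homeomorphism $\phi$ of an open $U\subseteq E$ onto an open $V\subseteq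 C$. Two charts are $C^k$ compatible if $U\cap U'=\emptyset$ or $\phi'\circ\phi^{-1}:\phi[U\cap U']\to\phi'[U\cap U']$ is a $C^k$ diffeomorphism. A $C^k$-*atlas* $A$ is a set of mutually $C^k$ compatible charts that cover $E$, at least one $V$ of which contains a ball of the ambient space; it is maximal if no further $C^k$ compatible chart can be added. A $C^k$ *manifold* is a triple $S=(A,E,C)$ with $A$ a maximal $C^k$-atlas. A *morphism* $S^1\to S^2$ is a pair $(f_0,f_1)$, $f_0:E^1\to E^2$ continuous, $f_1:C^1\to C^2$ $C^k$, such that for all $(U^i,V^i,\phi^i)\in A^i$ and $x\in U^1\cap f_0^{-1}[U^2]$ there are open $U'^1\subseteq U^1\cap f_0^{-1}[U^2]$, $V'^1\subseteq V^1$, $U'^2\subseteq U^2$, $V'^2\subseteq V^2$, $\hat V\subseteq C^2$ and a $C^k$ diffeomorphism $\hat f:V'^2\to\hat V$ with $x\in U'^1$, $f_1\phi^1(x)\in\hat V$, $f_0[U'^1]\subseteq U'^2$, $\phi^1[U'^1]\subseteq V'^1$, $f_1[V'^1]\subseteq\hat V$, $\phi^2[U'^2]\subseteq V'^2$ and $\hat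 f\circ\phi^2\circ f_0=f_1\circ\phi^1$ on $U'^1$. $\mathrm{Man}^{C^k}(\mathbf E,\mathbf C)$ consists of the manifolds with $E\in\mathbf E$, $C\in\mathbf C$ and of the arrows $((f_0,f_1),S^1,S^2)$. An *m-chart* of a model space $M_0$ in a model space $M_1$ is a chart with $U$, $V$ model neighborhoods and $\phi$ a model homeomorphism; m-compatibility, m-atlas (covering $M_0$), maximal m-atlas and m-atlas morphism are defined as above, with "isomorphism of the category of the coordinate model space" for "$C^k$ diffeomorphism" and "model neighborhood" for "open set" (and no condition about balls). A *local 2-$\emptyset$ coordinate space* is $L=((\mathcal E,\mathcal C),(M_0,M_1),A,\emptyset,\emptyset)$ with model categories $\mathcal E,\mathcal C$, objects $M_0\in\mathcal E$, $M_1\in\mathcal C$ and $A$ a maximal m-atlas of $M_0$ in $M_1$. A *morphism* $L\to L'$ is a pair of model functions $f_\alpha:M_\alpha\to M'_\alpha$ that is an m-atlas morphism; it is *strict* if $\mathcal E$, $\mathcal C$ are full subcategories of $\mathcal E'$, $\mathcal C'$ and $f_0\in\mathcal E'$, $f_1\in\mathcal C'$. For $S=(A,E,C)$ put $F_1^{\min}S=\mathrm{Mod}_{\min}(\{U\},\{\phi'^{-1}\circ\phi\})$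 (a model space of open sets of $E$) and $F_2^{\min}S=\mathrm{Mod}_{\min}(\{V\},\{\phi'\circ\phi^{-1}\})$ (of open sets of $C$), over all charts, resp. pairs of charts of $A$ with $U\cap U'\neq\emptyset$, the functions being taken on their natural domains, and - $F^{C^k}S=((\mathrm{sing}(\mathrm{Triv}E),\mathrm{sing}_{C^k}(\mathrm{Triv}_{C^k}C)),(\mathrm{Triv}E,\mathrm{Triv}_{C^k}C),A,\emptyset,\emptyset)$, - $F^{C^k,\mathcal M}S=(\mathcal M,(\mathrm{Triv}E,\mathrm{Triv}_{C^k}C),A,\emptyset,\emptyset)$, - $F^{\min C^k}S=((\mathrm{sing}(F_1^{\min}S),\mathrm{sing}_{C^k}(F_2^{\min}S)),(F_1^{\min}S,F_2^{\min}S),A,\emptyset,\emptyset)$, - $F^{\min C^k,\mathcal M}S=(\mathcal M,(F_1^{\min}S,F_2^{\min}S),A,\emptyset,\emptyset)$, for a pair $\mathcal M$ of categories; each $F$ sends an arrow $(f,S^1,S^2)$ to $(f,FS^1,FS^2)$. $\mathrm{LCS}^{C^k}$, $\mathrm{LCS}^{C^k,\mathcal M}$, $\mathrm{LCS}^{\min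 C^k}$, $\mathrm{LCS}^{\min C^k,\hat{\mathcal M}}$ (all over $(\mathbf E,\mathbf C)$) consist of the images of the objects and arrows of $\mathrm{Man}^{C^k}(\mathbf E,\mathbf C)$ under $F^{C^k}$, $F^{C^k,\mathcal M}$, $F^{\min C^k}$, $F^{\min C^k,\hat{\mathcal M}}$, with composition of the pairs of functions. **Theorem.** Let $\mathbf E$ be a set of topological spaces, $\mathbf C$ a set of linear spaces, $\mathcal E,\hat{\mathcal E}$ model categories, $\mathcal C,\hat{\mathcal C}$ $C^k$ linear model categories, $\mathcal M=(\mathcal E,\mathcal C)$, $\hat{\mathcal M}=(\hat{\mathcal E},\hat{\mathcal C})$, with $\mathrm{Trivcat}\,\mathbf E\subseteq\mathcal E\subseteq\hat{\mathcal E}$ and $\mathrm{Trivcat}_{C^k}\mathbf C\subseteq\mathcal C\subseteq\hat{\mathcal C}$ as subcategories. Then: 1. $\mathrm{LCS}^{C^k}(\mathbf E,\mathbf C)$, $\mathrm{LCS}^{C^k,\mathcal M}(\mathbf E,\mathbf C)$, $\mathrm{LCS}^{\min C^k}(\mathbf E,\mathbf C)$ and $\mathrm{LCS}^{\min C^k,\hat{\mathcal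 M}}(\mathbf E,\mathbf C)$ are categories, the identity of $L$ being $((\mathrm{Id},\mathrm{Id}),L,L)$; the functions of each arrow map the underlying spaces of the model spaces of its source into those of its target. 2. $F^{C^k}$, $F^{C^k,\mathcal M}$, $F^{\min C^k}$ and $F^{\min C^k,\hat{\mathcal M}}$ are functors from the category $\mathrm{Man}^{C^k}(\mathbf E,\mathbf C)$ to these categories, respectively. 3. For each object $S$ of $\mathrm{Man}^{C^k}(\mathbf E,\mathbf C)$, the tuples $F^{C^k}S$, $F^{C^k,\mathcal M}S$, $F^{C^k,\hat{\mathcal M}}S$ and $F^{\min C^k}S$ are local 2-$\emptyset$ coordinate spaces, and so is $F^{\min C^k,\hat{\mathcal M}}S$ if $F_1^{\min}S\in\hat{\mathcal E}$ and $F_2^{\min}S\in\hat{\mathcal C}$. 4. For each arrow $f=(f_0,f_1):S^1\to S^2$ of $\mathrm{Man}^{C^k}(\mathbf E,\mathbf C)$, $f$ is a morphism from $F^{C^k}S^1$ to each of $F^{C^k}S^2$, $F^{C^k,\mathcal M}S^2$ and $F^{C^k,\hat{\mathcal M}}S^2$, a strict morphism from $F^{C^k,\mathcal M}S^1$ to $F^{C^k,\mathcal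 M}S^2$, and a strict morphism from $F^{C^k,\hat{\mathcal M}}S^1$ to $F^{C^k,\hat{\mathcal M}}S^2$. If $f_j$ is a model function from $F_{j+1}^{\min}S^1$ to $F_{j+1}^{\min}S^2$ ($j=0,1$), then $f$ is a morphism from $F^{\min C^k}S^1$ to $F^{\min C^k}S^2$. If $f_0:F_1^{\min}S^1\to F_1^{\min}S^2$ is a morphism of $\hat{\mathcal E}$ and $f_1:F_2^{\min}S^1\to F_2^{\min}S^2$ one of $\hat{\mathcal C}$, then $f$ is a strict morphism from $F^{\min C^k,\hat{\mathcal M}}S^1$ to $F^{\min C^k,\hat{\mathcal M}}S^2$. -/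

import Mathlib

open TopologicalSpace

universe u v w

namespace LocalCoord

/-! ## Differential calculus on Banach and Fréchet spaces -/

/-- The class of linear spaces that is used: Banach spaces or Fréchet spaces. -/
inductive Setting
  | banach
  | frechet

/-- `C^n` maps (`n` finite) between Hausdorff topological vector spaces over `𝕂`, on an open set
`O`, in the sense of Michal-Bastiani (Keller's `C^n_c`), in the formulation with difference
quotients: `f` is `C^0` if it is continuous, and `C^{n+1}` if it is continuous and the difference
quotient `(f (x + t v) - f x) / t` extends to a `C^n` map `q` of `(x, v, t)` up to `t = 0`. -/
def TVSContDiffOn (𝕂 : Type) [RCLike 𝕂] {W : Type v} [AddCommGroup W] [Module 𝕂 W]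
    [TopologicalSpace W] :
    ℕ → ∀ {V : Type v} [AddCommGroup V] [Module 𝕂 V] [TopologicalSpace V], (V → W) → Set V → Prop
  | 0, _, _, _, _, f, O => ContinuousOn f O
  | n + 1, V, _, _, _, f, O =>
      ContinuousOn f O ∧
        ∃ q : V × V × 𝕂 → W,
          (∀ (x v : V) (t : 𝕂), x ∈ O → x + t • v ∈ O → f (x + t • v) - f x = t • q (x, v, t)) ∧
          TVSContDiffOn 𝕂 n q {p | p.1 ∈ O ∧ p.1 + p.2.2 • p.2.1 ∈ O}

/-- The complexification `V ⊕ iV` of a real vector space `V`; the scalars `𝕜` are only used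
through the real numbers contained in them. -/
structure Cplx (𝕜 : Type) (V : Type v) : Type v where
  re : V
  im : V

namespace Cplx

variable {𝕜 : Type} {V : Type v}

/-- A vector of the complexification is a pair of vectors. -/
def equivProd : Cplx 𝕜 V ≃ V × V where
  toFun z := (z.re, z.im)
  invFun p := ⟨p.1, p.2⟩
  left_inv _ := rfl
  right_inv _ := rfl

/-- The real vectors of the complexification. -/
def ofReal [Zero V] (x : V) : Cplx 𝕜 V := ⟨x, 0⟩

instance [TopologicalSpace V] : TopologicalSpace (Cplx 𝕜 V) :=
  TopologicalSpace.induced equivProd inferInstance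

instance [AddCommGroup V] : AddCommGroup (Cplx 𝕜 V) := equivProd.addCommGroup

instance [RCLike 𝕜] [AddCommGroup V] [Module 𝕜 V] : SMul ℂ (Cplx 𝕜 V) where
  smul z p :=
    ⟨(z.re : 𝕜) • p.re - (z.im : 𝕜) • p.im, (z.re : 𝕜) • p.im + (z.im : 𝕜) • p.re⟩

theorem ext' {p q : Cplx 𝕜 V} (h₁ : p.re = q.re) (h₂ : p.im = q.im) : p = q := by
  cases p; cases q; cases h₁; cases h₂; rfl

section LinearStructure
variable [AddCommGroup V]

theorem add_re (p q : Cplx 𝕜 V) : (p + q).re = p.re + q.re := rfl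
theorem add_im (p q : Cplx 𝕜 V) : (p + q).im = p.im + q.im := rfl
theorem zero_re : (0 : Cplx 𝕜 V).re = 0 := rfl
theorem zero_im : (0 : Cplx 𝕜 V).im = 0 := rfl

variable [RCLike 𝕜] [Module 𝕜 V]

theorem smul_re (z : ℂ) (p : Cplx 𝕜 V) :
    (z • p).re = (z.re : 𝕜) • p.re - (z.im : 𝕜) • p.im := rfl
theorem smul_im (z : ℂ) (p : Cplx 𝕜 V) :
    (z • p).im = (z.re : 𝕜) • p.im + (z.im : 𝕜) • p.re := rfl

instance : Module ℂ (Cplx 𝕜 V) where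
  one_smul p := by apply ext' <;> simp [smul_re, smul_im]
  mul_smul z z' p := by
    apply ext' <;> simp only [smul_re, smul_im, Complex.mul_re, Complex.mul_im, RCLike.ofReal_sub,
      RCLike.ofReal_add, RCLike.ofReal_mul] <;> module
  smul_zero z := by apply ext' <;> simp [smul_re, smul_im, zero_re, zero_im]
  smul_add z p q := by
    apply ext' <;> simp only [smul_re, smul_im, add_re, add_im] <;> module
  add_smul z z' p := by
    apply ext' <;> simp only [smul_re, smul_im, add_re, add_im, Complex.add_re, Complex.add_im,
      RCLike.ofReal_add] <;> module
  zero_smul p := by apply ext' <;> simp [smul_re, smul_im, zero_re, zero_im]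

end LinearStructure

end Cplx

/-- Real analytic maps on an open set `O` of a real topological vector space: locally they extend
to complex analytic (i.e. complex smooth) maps between open sets of the complexifications. -/
def RealAnalyticOn (𝕜 : Type) [RCLike 𝕜] {V W : Type v}
    [AddCommGroup V] [Module 𝕜 V] [TopologicalSpace V]
    [AddCommGroup W] [Module 𝕜 W] [TopologicalSpace W] (f : V → W) (O : Set V) : Prop :=
  ∀ x ∈ O, ∃ (U : Set (Cplx 𝕜 V)) (F : Cplx 𝕜 V → Cplx 𝕜 W),
    IsOpen U ∧ Cplx.ofReal x ∈ U ∧ (∀ n : ℕ, TVSContDiffOn ℂ n F U) ∧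
      ∀ y ∈ O, Cplx.ofReal y ∈ U → F (Cplx.ofReal y) = Cplx.ofReal (f y)

/-- `C^k` maps on an open set of a Fréchet space, `k = 0, 1, …, ∞, ω`. If the scalars are complex
(`RCLike.I ≠ 0`) then smooth maps are analytic, so that nothing is to be added for `k = ω`. -/
def FrechetContDiffOn (𝕜 : Type) [RCLike 𝕜] (k : WithTop ℕ∞) {V W : Type v}
    [AddCommGroup V] [Module 𝕜 V] [TopologicalSpace V]
    [AddCommGroup W] [Module 𝕜 W] [TopologicalSpace W] (f : V → W) (O : Set V) : Prop :=
  (∀ n : ℕ, (n : WithTop ℕ∞) ≤ k → TVSContDiffOn 𝕜 n f O) ∧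
    (k = ⊤ → (RCLike.I : 𝕜) = 0 → RealAnalyticOn 𝕜 f O)

/-- A Banach space, or a Fréchet space (a complete Hausdorff topological vector space whose
topology is given by countably many seminorms), over `𝕜`. -/
inductive Ambient (𝕜 : Type) [RCLike 𝕜] : Setting → Type (v + 1)
  | banach (V : Type v) [NormedAddCommGroup V] [NormedSpace 𝕜 V] [CompleteSpace V] :
      Ambient 𝕜 .banach
  | frechet (V : Type v) [AddCommGroup V] [Module 𝕜 V] [UniformSpace V] [IsUniformAddGroup V]
      [CompleteSpace V] [T2Space V]
      (hV : ∃ p : SeminormFamily 𝕜 V ℕ, WithSeminorms p) : Ambient 𝕜 .frechet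

section Spaces

variable {𝕜 : Type} [RCLike 𝕜] {σ : Setting}

/-- The underlying topological space of a Banach or Fréchet space. -/
def Ambient.pts : ∀ {σ : Setting}, Ambient.{v} 𝕜 σ → TopCat.{v}
  | _, @Ambient.banach _ _ V _ _ _ => TopCat.of V
  | _, @Ambient.frechet _ _ V _ _ _ _ _ _ _ => TopCat.of V

/-- `C^k` maps on an open set `O` of a Banach or Fréchet space: in the Fréchet sense between
Banach spaces, in the sense of Michal-Bastiani between Fréchet spaces. -/
def Ambient.ContDiffOn (k : WithTop ℕ∞) :
    ∀ {σ : Setting} (V W : Ambient.{v} 𝕜 σ), (V.pts → W.pts) → Set V.pts → Prop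
  | _, @Ambient.banach _ _ V _ _ _, @Ambient.banach _ _ W _ _ _, f, O =>
      _root_.ContDiffOn 𝕜 k (E := V) (F := W) f O
  | _, @Ambient.frechet _ _ V _ _ _ _ _ _ _, @Ambient.frechet _ _ W _ _ _ _ _ _ _, f, O =>
      FrechetContDiffOn 𝕜 k (V := V) (W := W) f O

/-- Let `e` be the inclusion of a subspace `ι` of `V`. The map `h` from `ι` to (a subspace of) `W`
is `C^k`: it is continuous and, if `k ≠ 0`, each point of `ι` has an open neighbourhood `O` in `V`
such that `h` extends to a `C^k` map on `O`. -/
def IsCk (k : WithTop ℕ∞) {V W : Ambient.{v} 𝕜 σ} {ι : Type v} [TopologicalSpace ι]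
    (e : ι → V.pts) (h : ι → W.pts) : Prop :=
  Continuous h ∧
    (k ≠ 0 → ∀ i : ι, ∃ (O : Set V.pts) (G : V.pts → W.pts), IsOpen O ∧ e i ∈ O ∧
      V.ContDiffOn k W G O ∧ ∀ j : ι, e j ∈ O → G (e j) = h j)

/-- A linear space: a locally arcwise connected subspace, with non-void interior, of a Banach or
Fréchet space. -/
structure LinearSpace (𝕜 : Type) [RCLike 𝕜] (σ : Setting) : Type (v + 1) where
  amb : Ambient.{v} 𝕜 σ
  carrier : Set amb.pts
  locallyArcwise : LocallyPathConnectedSpace carrier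
  nonvoid : (interior carrier).Nonempty

/-- The topological space of a linear space. -/
def LinearSpace.toTop (C : LinearSpace.{v} 𝕜 σ) : TopCat.{v} := TopCat.of C.carrier

/-- The inclusion of a linear space in its Banach or Fréchet space. -/
def LinearSpace.incl (C : LinearSpace.{v} 𝕜 σ) : C.toTop → C.amb.pts :=
  fun x : C.carrier => (x : C.amb.pts)

/-- An open subset of `C` contains a ball of the underlying Banach or Fréchet space. -/
def LinearSpace.ContainsBall (C : LinearSpace.{v} 𝕜 σ) (V : Opens C.toTop) : Prop :=
  (interior (C.incl '' (V : Set C.toTop))).Nonempty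

/-- `C^k` maps between open subsets of linear spaces. -/
def IsCkMap (k : WithTop ℕ∞) {C C' : LinearSpace.{v} 𝕜 σ} {A : Opens C.toTop} {B : Opens C'.toTop}
    (f : A → B) : Prop :=
  IsCk k (V := C.amb) (W := C'.amb) (fun x : A => C.incl x) (fun x : A => C'.incl (f x))

end Spaces

/-! ## Model spaces -/

/-- The data of a model space whose underlying space `S` is an open subspace of `X`: a set of
open sets (the model neighborhoods) and a set of functions between any two open sets. -/
structure ModelSpace (X : Type u) [TopologicalSpace X] : Type u where
  S : Opens X
  Ob : Set (Opens X)
  Hom : ∀ A B : Opens X, Set (A → B)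

namespace ModelSpace

variable {X : Type u} [TopologicalSpace X]

/-- The conditions on a model space: the model neighborhoods cover `S` and are closed under
finite intersections; the functions are continuous and form a category, and they satisfy the
restriction, inclusion and (restricted) sheaf conditions. -/
structure IsModelSpace (M : ModelSpace X) : Prop where
  cover : sSup M.Ob = M.S
  inter : ∀ A ∈ M.Ob, ∀ B ∈ M.Ob, A ⊓ B ∈ M.Ob
  dom_mem : ∀ (A B : Opens X) (f : A → B), f ∈ M.Hom A B → A ∈ M.Ob
  cod_mem : ∀ (A B : Opens X) (f : A → B), f ∈ M.Hom A B → B ∈ M.Ob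
  id_mem : ∀ A ∈ M.Ob, (id : A → A) ∈ M.Hom A A
  comp_mem : ∀ (A B D : Opens X) (f : A → B) (g : B → D),
    f ∈ M.Hom A B → g ∈ M.Hom B D → g ∘ f ∈ M.Hom A D
  continuous : ∀ (A B : Opens X) (f : A → B), f ∈ M.Hom A B → Continuous f
  restrict : ∀ (A B A' B' : Opens X) (f : A → B) (g : A' → B') (hA : A' ≤ A),
    f ∈ M.Hom A B → A' ∈ M.Ob → B' ∈ M.Ob → B' ≤ B →
    (∀ x : A', (g x : X) = f ⟨x, hA x.2⟩) → g ∈ M.Hom A' B'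
  inclusion : ∀ (A' A : Opens X) (hA : A' ≤ A), A' ∈ M.Ob → A ∈ M.Ob →
    (fun x : A' => (⟨x, hA x.2⟩ : A)) ∈ M.Hom A' A
  sheaf : ∀ (ι : Type u) (U V : ι → Opens X) (f : ∀ i, U i → V i),
    (∀ i, f i ∈ M.Hom (U i) (V i)) →
    ∀ (A B : Opens X), A ∈ M.Ob → B ∈ M.Ob → A = ⨆ i, U i → B = ⨆ i, V i →
    ∀ g : A → B, Continuous g →
    (∀ (i : ι) (x : U i) (hx : (x : X) ∈ A), (g ⟨x, hx⟩ : X) = f i x) → g ∈ M.Hom A B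

/-- The bijection `e` is an isomorphism of the category of the model space. -/
def IsIso (M : ModelSpace X) {A B : Opens X} (e : A ≃ B) : Prop :=
  (e : A → B) ∈ M.Hom A B ∧ (e.symm : B → A) ∈ M.Hom B A

/-- The trivial model space of `X`: all open sets and all continuous functions between them. -/
def triv (X : Type u) [TopologicalSpace X] : ModelSpace X where
  S := ⊤
  Ob := Set.univ
  Hom _ _ := {f | Continuous f}

/-- The minimal model space with neighborhoods `O` and neighborhood mappings `F`: its underlying
space is `⋃ O`, and its category is the smallest one that contains `O` and `F` and satisfies the
conditions on a model space. -/
def minimal (O : Set (Opens X)) (F : ∀ A B : Opens X, Set (A → B)) : ModelSpace X where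
  S := sSup O
  Ob := {A | ∀ N : ModelSpace X, N.IsModelSpace → N.S = sSup O → O ⊆ N.Ob →
    (∀ A B, F A B ⊆ N.Hom A B) → A ∈ N.Ob}
  Hom A B := {f | ∀ N : ModelSpace X, N.IsModelSpace → N.S = sSup O → O ⊆ N.Ob →
    (∀ A B, F A B ⊆ N.Hom A B) → f ∈ N.Hom A B}

/-- Model functions: continuous functions for which inverse images of model neighborhoods are
model neighborhoods and images of model neighborhoods are contained in model neighborhoods. -/
def IsModelFunction {Y : Type w} [TopologicalSpace Y] (M : ModelSpace X) (N : ModelSpace Y)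
    (g : M.S → N.S) : Prop :=
  Continuous g ∧
    (∀ V ∈ N.Ob, ∃ U ∈ M.Ob, ∀ x : X, x ∈ U ↔ ∃ hx : x ∈ M.S, (g ⟨x, hx⟩ : Y) ∈ V) ∧
    (∀ U ∈ M.Ob, ∃ V ∈ N.Ob, ∀ x : M.S, (x : X) ∈ U → (g x : Y) ∈ V)

/-- A self-map of (the space of) a model space that is locally a morphism of its category. -/
def IsLocallyMorphism (M : ModelSpace X) (g : M.S → M.S) : Prop :=
  ∀ u : M.S, ∃ (U V : Opens X) (f : U → V), (u : X) ∈ U ∧ f ∈ M.Hom U V ∧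
    ∀ (x : U) (hx : (x : X) ∈ M.S), (g ⟨x, hx⟩ : X) = f x

end ModelSpace

section LinearModel

variable {𝕜 : Type} [RCLike 𝕜] {σ : Setting}

/-- The trivial `C^k` linear model space of `C`: all open sets of `C`, all `C^k` functions between
them. -/
def trivCk (k : WithTop ℕ∞) (C : LinearSpace.{v} 𝕜 σ) : ModelSpace C.toTop where
  S := ⊤
  Ob := Set.univ
  Hom _ _ := {f | IsCkMap k f}

/-- `C^k` linear model spaces: the underlying space is a linear space (as an open subspace of the
linear space `C` it is one as soon as its interior is not void) and all morphisms are `C^k`. -/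
def IsCkLinearModelSpace (k : WithTop ℕ∞) {C : LinearSpace.{v} 𝕜 σ} (M : ModelSpace C.toTop) :
    Prop :=
  M.IsModelSpace ∧ C.ContainsBall M.S ∧
    ∀ (A B : Opens C.toTop) (f : A → B), f ∈ M.Hom A B → IsCkMap k f

end LinearModel

/-! ## Charts and atlases -/

/-- A chart `(U, V, φ)`: a homeomorphism from an open set of `X` onto an open set of `Y`. -/
structure Chart (X : Type u) [TopologicalSpace X] (Y : Type v) [TopologicalSpace Y] :
    Type (max u v) where
  U : Opens X
  V : Opens Y
  φ : U ≃ₜ V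

section Charts

variable {X : Type u} [TopologicalSpace X] {Y : Type v} [TopologicalSpace Y]

/-- The inverse `(V, U, φ⁻¹)` of a chart. -/
def Chart.symm (c : Chart X Y) : Chart Y X := ⟨c.V, c.U, c.φ.symm⟩

/-- The image `φ[W ∩ U]` of an open set `W`. -/
def Chart.image (c : Chart X Y) (W : Opens X) : Opens Y where
  carrier := Subtype.val '' (c.φ '' (Subtype.val ⁻¹' (W : Set X)))
  is_open' := c.V.isOpen.isOpenMap_subtype_val _
    (c.φ.isOpenMap _ (W.isOpen.preimage continuous_subtype_val))

/-- `t` is the transition function `φ' ∘ φ⁻¹` from `φ[U ∩ U']` to `φ'[U ∩ U']`. -/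
def IsTransition (c c' : Chart X Y) (t : c.image c'.U → c'.image c.U) : Prop :=
  ∀ (x : X) (hx : x ∈ c.U) (hx' : x ∈ c'.U) (hy : (c.φ ⟨x, hx⟩ : Y) ∈ c.image c'.U),
    (t ⟨c.φ ⟨x, hx⟩, hy⟩ : Y) = c'.φ ⟨x, hx'⟩

/-- m-charts: `U` and `V` are model neighborhoods and `φ` is a model homeomorphism. -/
def IsMChart (M : ModelSpace X) (N : ModelSpace Y) (c : Chart X Y) : Prop :=
  c.U ∈ M.Ob ∧ c.V ∈ N.Ob ∧
    (∀ W ∈ N.Ob, W ≤ c.V → c.symm.image W ∈ M.Ob) ∧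
    (∀ W ∈ M.Ob, W ≤ c.U → c.image W ∈ N.Ob)

/-- m-compatibility: the coordinate patches are disjoint or the transition function is an
isomorphism of the category of the coordinate space. -/
def MCompatible (N : ModelSpace Y) (c c' : Chart X Y) : Prop :=
  Disjoint c.U c'.U ∨ ∃ t : c.image c'.U ≃ c'.image c.U, IsTransition c c' t ∧ N.IsIso t

/-- m-atlases: sets of mutually m-compatible m-charts that cover the total space. -/
structure IsMAtlas (M : ModelSpace X) (N : ModelSpace Y) (A : Set (Chart X Y)) : Prop where
  chart : ∀ c ∈ A, IsMChart M N c
  compatible : ∀ c ∈ A, ∀ c' ∈ A, MCompatible N c c'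
  cover : ∀ x ∈ M.S, ∃ c ∈ A, x ∈ c.U

/-- Maximal m-atlases cannot be extended by a further m-compatible m-chart. -/
def IsMaximalMAtlas (M : ModelSpace X) (N : ModelSpace Y) (A : Set (Chart X Y)) : Prop :=
  IsMAtlas M N A ∧ ∀ c : Chart X Y, IsMChart M N c → (∀ c' ∈ A, MCompatible N c c') → c ∈ A

variable {X' : Type u} [TopologicalSpace X'] {Y' : Type v} [TopologicalSpace Y']

/-- The sets `U₁ ⊆ U ∩ f₀⁻¹[U']`, `V₁ ⊆ V`, `U₂ ⊆ U'`, `V₂ ⊆ V'`, `Vh` and the bijection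
`fh` from `V₂` to `Vh` complete the diagram of `f₀`, `f₁`, `φ`, `φ'` at `x`: `x ∈ U₁`,
`f₁ (φ x) ∈ Vh`, `f₀[U₁] ⊆ U₂`, `φ[U₁] ⊆ V₁`, `f₁[V₁] ⊆ Vh`, `φ'[U₂] ⊆ V₂` and
`fh ∘ φ' ∘ f₀ = f₁ ∘ φ` on `U₁`. -/
structure Completes (f₀ : X → X') (f₁ : Y → Y') (c : Chart X Y) (c' : Chart X' Y') (x : X)
    (U₁ : Opens X) (V₁ : Opens Y) (U₂ : Opens X') (V₂ Vh : Opens Y') (fh : V₂ ≃ Vh) : Prop where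
  U₁_le : U₁ ≤ c.U
  U₁_sub : ∀ z ∈ U₁, f₀ z ∈ c'.U
  V₁_le : V₁ ≤ c.V
  U₂_le : U₂ ≤ c'.U
  V₂_le : V₂ ≤ c'.V
  x_mem : x ∈ U₁
  fx_mem : ∀ hx : x ∈ c.U, f₁ (c.φ ⟨x, hx⟩) ∈ Vh
  f₀_image : ∀ z ∈ U₁, f₀ z ∈ U₂
  φ_image : ∀ (z : X) (hz : z ∈ c.U), z ∈ U₁ → (c.φ ⟨z, hz⟩ : Y) ∈ V₁
  f₁_image : ∀ y ∈ V₁, f₁ y ∈ Vh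
  φ'_image : ∀ (z : X') (hz : z ∈ c'.U), z ∈ U₂ → (c'.φ ⟨z, hz⟩ : Y') ∈ V₂
  comm : ∀ (z : X) (hz : z ∈ c.U) (hz' : f₀ z ∈ c'.U) (hV : (c'.φ ⟨f₀ z, hz'⟩ : Y') ∈ V₂),
    z ∈ U₁ → (fh ⟨c'.φ ⟨f₀ z, hz'⟩, hV⟩ : Y') = f₁ (c.φ ⟨z, hz⟩)

/-- `(f₀, f₁)` is an m-atlas morphism from `A` to `A'`: for all charts of `A` and `A'` the diagram
of `f₀`, `f₁` and the coordinate functions is locally nearly commutative in the coordinate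
space of `A'`. -/
def IsMAtlasMorphism (M : ModelSpace X) (N : ModelSpace Y) (A : Set (Chart X Y))
    (M' : ModelSpace X') (N' : ModelSpace Y') (A' : Set (Chart X' Y'))
    (f₀ : X → X') (f₁ : Y → Y') : Prop :=
  ∀ c ∈ A, ∀ c' ∈ A', ∀ x ∈ c.U, f₀ x ∈ c'.U →
    ∃ U₁ ∈ M.Ob, ∃ V₁ ∈ N.Ob, ∃ U₂ ∈ M'.Ob, ∃ V₂ ∈ N'.Ob, ∃ Vh ∈ N'.Ob, ∃ fh : V₂ ≃ Vh,
      N'.IsIso fh ∧ Completes f₀ f₁ c c' x U₁ V₁ U₂ V₂ Vh fh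

end Charts

section CkAtlases

variable {𝕜 : Type} [RCLike 𝕜] {σ : Setting}

/-- `C^k` diffeomorphisms between open sets of a linear space. -/
def IsCkDiffeo (k : WithTop ℕ∞) {C : LinearSpace.{v} 𝕜 σ} {A B : Opens C.toTop} (e : A ≃ B) :
    Prop :=
  IsCkMap k (e : A → B) ∧ IsCkMap k (e.symm : B → A)

/-- `C^k` compatibility of charts. -/
def CkCompatible (k : WithTop ℕ∞) {E : TopCat.{u}} {C : LinearSpace.{v} 𝕜 σ}
    (c c' : Chart E C.toTop) : Prop :=
  Disjoint c.U c'.U ∨ ∃ t : c.image c'.U ≃ c'.image c.U, IsTransition c c' t ∧ IsCkDiffeo k t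

/-- A set of charts, considered as an atlas of `E` in the coordinate space `C`. -/
structure AtlasTriple (𝕜 : Type) [RCLike 𝕜] (σ : Setting) : Type (max u v + 1) where
  E : TopCat.{u}
  C : LinearSpace.{v} 𝕜 σ
  A : Set (Chart E C.toTop)

/-- `C^k`-atlases: mutually `C^k` compatible charts that cover `E`; the range of at least one of
them contains a ball. -/
structure IsCkAtlas (k : WithTop ℕ∞) (T : AtlasTriple.{u, v} 𝕜 σ) : Prop where
  compatible : ∀ c ∈ T.A, ∀ c' ∈ T.A, CkCompatible k c c'
  cover : ∀ x : T.E, ∃ c ∈ T.A, x ∈ c.U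
  ball : ∃ c ∈ T.A, T.C.ContainsBall c.V

/-- Maximal `C^k`-atlases cannot be extended by a further `C^k` compatible chart; such a triple is
a `C^k` manifold. -/
def IsMaximalCkAtlas (k : WithTop ℕ∞) (T : AtlasTriple.{u, v} 𝕜 σ) : Prop :=
  IsCkAtlas k T ∧ ∀ c : Chart T.E T.C.toTop, (∀ c' ∈ T.A, CkCompatible k c c') → c ∈ T.A

/-- Pairs of functions between the total spaces and between the coordinate spaces. -/
abbrev FunPair (T T' : AtlasTriple.{u, v} 𝕜 σ) : Type (max u v) :=
  (T.E → T'.E) × (T.C.toTop → T'.C.toTop)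

/-- `C^k`-morphisms between `C^k`-atlases. -/
structure IsCkMorphism (k : WithTop ℕ∞) (T T' : AtlasTriple.{u, v} 𝕜 σ) (f : FunPair T T') :
    Prop where
  continuous : Continuous f.1
  ck : IsCk k T.C.incl (fun y => T'.C.incl (f.2 y))
  nearlyComm : ∀ c ∈ T.A, ∀ c' ∈ T'.A, ∀ x ∈ c.U, f.1 x ∈ c'.U →
    ∃ (U₁ : Opens T.E) (V₁ : Opens T.C.toTop) (U₂ : Opens T'.E) (V₂ Vh : Opens T'.C.toTop)
      (fh : V₂ ≃ Vh), IsCkDiffeo k fh ∧ Completes f.1 f.2 c c' x U₁ V₁ U₂ V₂ Vh fh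

/-- Maximal `C^k`-morphisms: `C^k`-morphisms between maximal `C^k`-atlases, i.e. between `C^k`
manifolds. -/
def IsMaximalCkMorphism (k : WithTop ℕ∞) (T T' : AtlasTriple.{u, v} 𝕜 σ) (f : FunPair T T') :
    Prop :=
  IsMaximalCkAtlas k T ∧ IsMaximalCkAtlas k T' ∧ IsCkMorphism k T T' f

/-- The neighborhood mappings `φ'⁻¹ ∘ φ` of the total space, from `φ⁻¹[V ∩ V']` to `φ'⁻¹[V ∩ V']`,
for charts with `U ∩ U' ≠ ∅`. -/
inductive TotalGen (T : AtlasTriple.{u, v} 𝕜 σ) : ∀ A B : Opens T.E, (A → B) → Prop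
  | mk (c c' : Chart T.E T.C.toTop) (hc : c ∈ T.A) (hc' : c' ∈ T.A) (h : ¬ Disjoint c.U c'.U)
      (t : c.symm.image c'.symm.U → c'.symm.image c.symm.U) (ht : IsTransition c.symm c'.symm t) :
      TotalGen T _ _ t

/-- The transition functions `φ' ∘ φ⁻¹`, from `φ[U ∩ U']` to `φ'[U ∩ U']`, for charts with
`U ∩ U' ≠ ∅`. -/
inductive CoordGen (T : AtlasTriple.{u, v} 𝕜 σ) :
    ∀ A B : Opens T.C.toTop, (A → B) → Prop
  | mk (c c' : Chart T.E T.C.toTop) (hc : c ∈ T.A) (hc' : c' ∈ T.A) (h : ¬ Disjoint c.U c'.U)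
      (t : c.image c'.U → c'.image c.U) (ht : IsTransition c c' t) : CoordGen T _ _ t

/-- The minimal model space of the total space of an atlas, with the coordinate patches as
neighborhoods. -/
def minTotal (T : AtlasTriple.{u, v} 𝕜 σ) : ModelSpace T.E :=
  ModelSpace.minimal {U | ∃ c ∈ T.A, c.U = U} (fun A B => {f | TotalGen T A B f})

/-- The minimal model space of the coordinate space of an atlas, with the ranges of the charts as
neighborhoods and the transition functions as neighborhood mappings. -/
def minCoord (T : AtlasTriple.{u, v} 𝕜 σ) : ModelSpace T.C.toTop :=
  ModelSpace.minimal {V | ∃ c ∈ T.A, c.V = V} (fun A B => {f | CoordGen T A B f})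

end CkAtlases

/-! ## Model categories -/

/-- The data of a category of model spaces: a set of model spaces, for topological spaces `P s`,
and a set of functions between the underlying spaces of any two of them. Composition is the
composition of functions. -/
structure SpaceCat {𝔖 : Type w} (P : 𝔖 → TopCat.{u}) where
  Ob : Set (Σ s, ModelSpace (P s))
  Hom : ∀ M N : (Σ s, ModelSpace (P s)), Set (M.2.S → N.2.S)

namespace SpaceCat

variable {𝔖 : Type w} {P : 𝔖 → TopCat.{u}}

/-- Model categories: categories of model spaces and model functions. -/
structure IsModelCategory (K : SpaceCat P) : Prop where
  isModelSpace : ∀ M ∈ K.Ob, M.2.IsModelSpace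
  dom_mem : ∀ M N, ∀ f ∈ K.Hom M N, M ∈ K.Ob
  cod_mem : ∀ M N, ∀ f ∈ K.Hom M N, N ∈ K.Ob
  isModelFunction : ∀ M N, ∀ f ∈ K.Hom M N, M.2.IsModelFunction N.2 f
  id_mem : ∀ M ∈ K.Ob, id ∈ K.Hom M M
  comp_mem : ∀ M N Q, ∀ f ∈ K.Hom M N, ∀ g ∈ K.Hom N Q, g ∘ f ∈ K.Hom M Q

/-- Subcategories. -/
def IsSubcat (K L : SpaceCat P) : Prop :=
  K.Ob ⊆ L.Ob ∧ ∀ M N, K.Hom M N ⊆ L.Hom M N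

/-- Full subcategories. -/
def IsFullSubcat (K L : SpaceCat P) : Prop :=
  K.IsSubcat L ∧ ∀ M ∈ K.Ob, ∀ N ∈ K.Ob, L.Hom M N ⊆ K.Hom M N

/-- The model functions from a model space to itself that are locally morphisms. -/
inductive SingHom (M : Σ s, ModelSpace (P s)) :
    ∀ N Q : (Σ s, ModelSpace (P s)), (N.2.S → Q.2.S) → Prop
  | mk (f : M.2.S → M.2.S) (hf : M.2.IsModelFunction M.2 f) (hf' : M.2.IsLocallyMorphism f) :
      SingHom M M M f

/-- The singleton category of a model space: all model functions to itself that are locally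
morphisms. -/
def sing (M : Σ s, ModelSpace (P s)) : SpaceCat P where
  Ob := {M}
  Hom N Q := {f | SingHom M N Q f}

end SpaceCat

/-- Categories of model spaces for arbitrary topological spaces. -/
abbrev TopSpaceCat : Type (u + 1) := SpaceCat (fun E : TopCat.{u} => E)

/-- The model space `M` for the topological space `E`. -/
abbrev topModel {E : TopCat.{u}} (M : ModelSpace E) :
    Σ E : TopCat.{u}, ModelSpace E := ⟨E, M⟩

/-- The trivial model category of a set of topological spaces: all continuous functions between
their trivial model spaces. -/
def trivCat (Es : Set TopCat.{u}) : TopSpaceCat.{u} where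
  Ob := {M | ∃ E ∈ Es, M = topModel (ModelSpace.triv E)}
  Hom M N := {f | (∃ E ∈ Es, M = topModel (ModelSpace.triv E)) ∧
    (∃ E ∈ Es, N = topModel (ModelSpace.triv E)) ∧ Continuous f}

section LinearCats

variable {𝕜 : Type} [RCLike 𝕜] {σ : Setting}

/-- Categories of model spaces for linear spaces. -/
abbrev LinSpaceCat (𝕜 : Type) [RCLike 𝕜] (σ : Setting) : Type (v + 1) :=
  SpaceCat (LinearSpace.toTop : LinearSpace.{v} 𝕜 σ → TopCat.{v})

/-- The model space `M` for the linear space `C`. -/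
abbrev linModel {C : LinearSpace.{v} 𝕜 σ} (M : ModelSpace C.toTop) :
    Σ C : LinearSpace.{v} 𝕜 σ, ModelSpace C.toTop := ⟨C, M⟩

/-- `C^k` linear model categories: model categories whose objects are `C^k` linear model spaces and
whose morphisms are `C^k` model functions. -/
structure IsCkLinearModelCategory (k : WithTop ℕ∞) (K : LinSpaceCat.{v} 𝕜 σ) : Prop where
  isModelCategory : K.IsModelCategory
  isCkLinear : ∀ M ∈ K.Ob, IsCkLinearModelSpace k M.2
  isCk : ∀ M N, ∀ f ∈ K.Hom M N, IsCkMap k (C := M.1) (C' := N.1) f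

/-- The category of trivial `C^k` linear model spaces of a set of linear spaces: all `C^k`
functions between them. -/
def trivCatCk (k : WithTop ℕ∞) (Cs : Set (LinearSpace.{v} 𝕜 σ)) : LinSpaceCat.{v} 𝕜 σ where
  Ob := {M | ∃ C ∈ Cs, M = linModel (trivCk k C)}
  Hom M N := {f | (∃ C ∈ Cs, M = linModel (trivCk k C)) ∧ (∃ C ∈ Cs, N = linModel (trivCk k C)) ∧
    IsCkMap k (C := M.1) (C' := N.1) f}

/-- The `C^k` singleton category of a model space: all `C^k` model functions to itself. -/
def singCk (k : WithTop ℕ∞) (M : Σ C : LinearSpace.{v} 𝕜 σ, ModelSpace C.toTop) :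
    LinSpaceCat.{v} 𝕜 σ where
  Ob := {M}
  Hom N Q := {f | N = M ∧ Q = M ∧ N.2.IsModelFunction Q.2 f ∧ IsCkMap k (C := N.1) (C' := Q.1) f}

/-! ## Local coordinate spaces -/

/-- Two categories, and model spaces for the total space and the coordinate space of an atlas. -/
structure LCSData (T : AtlasTriple.{u, v} 𝕜 σ) where
  𝓔 : TopSpaceCat.{u}
  𝓒 : LinSpaceCat.{v} 𝕜 σ
  M₀ : ModelSpace T.E
  M₁ : ModelSpace T.C.toTop

/-- The data `((𝓔, 𝓒), (M₀, M₁), A, ∅, ∅)` of a local 2-∅ coordinate space, over linear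
coordinate spaces. There are no adjunct spaces and no adjunct functions. -/
structure LCS2 (𝕜 : Type) [RCLike 𝕜] (σ : Setting) : Type (max u v + 1) where
  base : AtlasTriple.{u, v} 𝕜 σ
  data : LCSData base

/-- Local 2-∅ coordinate spaces: the categories are model categories, the model spaces are objects
of them and `A` is a maximal m-atlas. -/
structure IsLCS (L : LCS2.{u, v} 𝕜 σ) : Prop where
  modelCat₀ : L.data.𝓔.IsModelCategory
  modelCat₁ : L.data.𝓒.IsModelCategory
  mem₀ : topModel L.data.M₀ ∈ L.data.𝓔.Ob
  mem₁ : linModel L.data.M₁ ∈ L.data.𝓒.Ob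
  maximal : IsMaximalMAtlas L.data.M₀ L.data.M₁ L.base.A

/-- `(f₀, f₁)` maps the underlying spaces of the model spaces into each other. -/
def MapsSpaces (L L' : LCS2.{u, v} 𝕜 σ) (f : FunPair L.base L'.base) : Prop :=
  (∀ x ∈ L.data.M₀.S, f.1 x ∈ L'.data.M₀.S) ∧ (∀ y ∈ L.data.M₁.S, f.2 y ∈ L'.data.M₁.S)

/-- The restriction of `f₀` to the underlying spaces of the model spaces. -/
def res₀ {L L' : LCS2.{u, v} 𝕜 σ} {f : FunPair L.base L'.base} (h : MapsSpaces L L' f) :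
    L.data.M₀.S → L'.data.M₀.S := fun x => ⟨f.1 x, h.1 x x.2⟩

/-- The restriction of `f₁` to the underlying spaces of the model spaces. -/
def res₁ {L L' : LCS2.{u, v} 𝕜 σ} {f : FunPair L.base L'.base} (h : MapsSpaces L L' f) :
    L.data.M₁.S → L'.data.M₁.S := fun y => ⟨f.2 y, h.2 y y.2⟩

/-- Morphisms of local 2-∅ coordinate spaces: pairs of model functions that form an m-atlas
morphism. (There are no adjunct functions to commute with.) -/
structure IsLCSMorphism (L L' : LCS2.{u, v} 𝕜 σ) (f : FunPair L.base L'.base) : Prop where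
  isLCS : IsLCS L
  isLCS' : IsLCS L'
  maps : MapsSpaces L L' f
  modelFun₀ : L.data.M₀.IsModelFunction L'.data.M₀ (res₀ maps)
  modelFun₁ : L.data.M₁.IsModelFunction L'.data.M₁ (res₁ maps)
  atlas : IsMAtlasMorphism L.data.M₀ L.data.M₁ L.base.A L'.data.M₀ L'.data.M₁ L'.base.A f.1 f.2

/-- Strict morphisms: the categories are full subcategories of those of the target, and `f₀`, `f₁`
are morphisms of the latter. -/
structure IsStrictLCSMorphism (L L' : LCS2.{u, v} 𝕜 σ) (f : FunPair L.base L'.base) : Prop where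
  morphism : IsLCSMorphism L L' f
  full₀ : L.data.𝓔.IsFullSubcat L'.data.𝓔
  full₁ : L.data.𝓒.IsFullSubcat L'.data.𝓒
  hom₀ : res₀ morphism.maps ∈ L'.data.𝓔.Hom (topModel L.data.M₀) (topModel L'.data.M₀)
  hom₁ : res₁ morphism.maps ∈ L'.data.𝓒.Hom (linModel L.data.M₁) (linModel L'.data.M₁)

/-- A way of adding categories and model spaces to the atlases. -/
abbrev DataFun (𝕜 : Type) [RCLike 𝕜] (σ : Setting) : Type (max u v + 1) :=
  ∀ T : AtlasTriple.{u, v} 𝕜 σ, LCSData T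

/-- The coordinate space that is built from an atlas. -/
def DataFun.toLCS (D : DataFun.{u, v} 𝕜 σ) (T : AtlasTriple.{u, v} 𝕜 σ) : LCS2.{u, v} 𝕜 σ :=
  ⟨T, D T⟩

/-- `F^{Ck}`: trivial model spaces in their singleton categories. -/
def dataCk (k : WithTop ℕ∞) : DataFun.{u, v} 𝕜 σ := fun T =>
  { 𝓔 := SpaceCat.sing (topModel (ModelSpace.triv T.E))
    𝓒 := singCk k (linModel (trivCk k T.C))
    M₀ := ModelSpace.triv T.E
    M₁ := trivCk k T.C }

/-- `F^{Ck, (𝓔, 𝓒)}`: trivial model spaces in the categories `𝓔`, `𝓒`. -/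
def dataCkIn (k : WithTop ℕ∞) (𝓔 : TopSpaceCat.{u}) (𝓒 : LinSpaceCat.{v} 𝕜 σ) :
    DataFun.{u, v} 𝕜 σ := fun T =>
  { 𝓔 := 𝓔
    𝓒 := 𝓒
    M₀ := ModelSpace.triv T.E
    M₁ := trivCk k T.C }

/-- `F^{min Ck}`: minimal model spaces in their singleton categories. -/
def dataMin (k : WithTop ℕ∞) : DataFun.{u, v} 𝕜 σ := fun T =>
  { 𝓔 := SpaceCat.sing (topModel (minTotal T))
    𝓒 := singCk k (linModel (minCoord T))
    M₀ := minTotal T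
    M₁ := minCoord T }

/-- `F^{min Ck, (𝓔, 𝓒)}`: minimal model spaces in the categories `𝓔`, `𝓒`. -/
def dataMinIn (𝓔 : TopSpaceCat.{u}) (𝓒 : LinSpaceCat.{v} 𝕜 σ) : DataFun.{u, v} 𝕜 σ := fun T =>
  { 𝓔 := 𝓔
    𝓒 := 𝓒
    M₀ := minTotal T
    M₁ := minCoord T }

end LinearCats

/-! ## Categories with labelled objects -/

/-- Objects and arrows `(f, A, B)` as sets inside of types of labels and maps, with a partial
operation of composition and with candidates for the identities. -/
structure PreCat where
  Lab : Type u
  Map : Lab → Lab → Type v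
  idMap : ∀ A, Map A A
  comp : ∀ {A B C}, Map A B → Map B C → Map A C
  Ob : Set Lab
  Ar : ∀ A B, Set (Map A B)

/-- The laws of a category, with the given identities. -/
structure PreCat.IsCategory (K : PreCat.{u, v}) : Prop where
  dom_mem : ∀ A B, ∀ f ∈ K.Ar A B, A ∈ K.Ob
  cod_mem : ∀ A B, ∀ f ∈ K.Ar A B, B ∈ K.Ob
  id_mem : ∀ A ∈ K.Ob, K.idMap A ∈ K.Ar A A
  comp_mem : ∀ A B C, ∀ f ∈ K.Ar A B, ∀ g ∈ K.Ar B C, K.comp f g ∈ K.Ar A C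
  id_comp : ∀ A B, ∀ f ∈ K.Ar A B, K.comp (K.idMap A) f = f
  comp_id : ∀ A B, ∀ f ∈ K.Ar A B, K.comp f (K.idMap B) = f
  assoc : ∀ A B C D, ∀ f ∈ K.Ar A B, ∀ g ∈ K.Ar B C, ∀ h ∈ K.Ar C D,
    K.comp (K.comp f g) h = K.comp f (K.comp g h)

/-- The laws of a functor between two categories. -/
structure PreCat.IsFunctor (K L : PreCat.{u, v}) (F : K.Lab → L.Lab)
    (Fm : ∀ A B, K.Map A B → L.Map (F A) (F B)) : Prop where
  source : K.IsCategory
  target : L.IsCategory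
  obj_mem : ∀ A ∈ K.Ob, F A ∈ L.Ob
  map_mem : ∀ A B, ∀ f ∈ K.Ar A B, Fm A B f ∈ L.Ar (F A) (F B)
  map_id : ∀ A ∈ K.Ob, Fm A A (K.idMap A) = L.idMap (F A)
  map_comp : ∀ A B C, ∀ f ∈ K.Ar A B, ∀ g ∈ K.Ar B C,
    Fm A C (K.comp f g) = L.comp (Fm A B f) (Fm B C g)

section Categories

variable {𝕜 : Type} [RCLike 𝕜] {σ : Setting}

/-- The category of `C^k` manifolds over `Es`, `Cs`: maximal `C^k`-atlases and maximal
`C^k`-morphisms. -/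
def manCk (k : WithTop ℕ∞) (Es : Set TopCat.{u}) (Cs : Set (LinearSpace.{v} 𝕜 σ)) :
    PreCat.{max u v + 1, max u v} where
  Lab := AtlasTriple.{u, v} 𝕜 σ
  Map T T' := FunPair T T'
  idMap _ := (id, id)
  comp f g := (g.1 ∘ f.1, g.2 ∘ f.2)
  Ob := {T | T.E ∈ Es ∧ T.C ∈ Cs ∧ IsMaximalCkAtlas k T}
  Ar T T' := {f | (T.E ∈ Es ∧ T.C ∈ Cs) ∧ (T'.E ∈ Es ∧ T'.C ∈ Cs) ∧ IsMaximalCkMorphism k T T' f}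

/-- The arrows `(f, F T, F T')`, for the arrows `(f, T, T')` of manifolds. -/
inductive LCSArrow (k : WithTop ℕ∞) (Es : Set TopCat.{u}) (Cs : Set (LinearSpace.{v} 𝕜 σ))
    (D : DataFun.{u, v} 𝕜 σ) :
    ∀ L L' : LCS2.{u, v} 𝕜 σ, FunPair L.base L'.base → Prop
  | mk (T T' : AtlasTriple.{u, v} 𝕜 σ) (f : FunPair T T') (hf : f ∈ (manCk k Es Cs).Ar T T') :
      LCSArrow k Es Cs D (D.toLCS T) (D.toLCS T') f

/-- The coordinate spaces `F T`, for the `C^k` manifolds `T` over `Es`, `Cs`, and the arrows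
`(f, F T, F T')`; the identity of `L` is `((id, id), L, L)`. -/
def lcsCat (k : WithTop ℕ∞) (Es : Set TopCat.{u}) (Cs : Set (LinearSpace.{v} 𝕜 σ))
    (D : DataFun.{u, v} 𝕜 σ) : PreCat.{max u v + 1, max u v} where
  Lab := LCS2.{u, v} 𝕜 σ
  Map L L' := FunPair L.base L'.base
  idMap _ := (id, id)
  comp f g := (g.1 ∘ f.1, g.2 ∘ f.2)
  Ob := {L | ∃ T ∈ (manCk k Es Cs).Ob, L = D.toLCS T}
  Ar L L' := {f | LCSArrow k Es Cs D L L' f}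

/-- `F` is a functor from the category of manifolds to the category of the spaces `F T`: it sends
`T` to `F T` and `(f, T, T')` to `(f, F T, F T')`. -/
def IsManFunctor (k : WithTop ℕ∞) (Es : Set TopCat.{u}) (Cs : Set (LinearSpace.{v} 𝕜 σ))
    (D : DataFun.{u, v} 𝕜 σ) : Prop :=
  (manCk k Es Cs).IsFunctor (lcsCat k Es Cs D) D.toLCS (fun _ _ f => f)

end Categories

end LocalCoord

open LocalCoord

namespace LocalCoord

/-! ## Composition of `C^k` maps -/

section TVS

variable {𝕂 : Type} [RCLike 𝕂]
  {V : Type v} [AddCommGroup V] [Module 𝕂 V] [TopologicalSpace V]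
  {W : Type v} [AddCommGroup W] [Module 𝕂 W] [TopologicalSpace W]
  {Z : Type v} [AddCommGroup Z] [Module 𝕂 Z] [TopologicalSpace Z]

/-! Two facts carry the theorem: the chain rule in both settings, and the closure of a maximal atlas
under restricting a chart and composing it with a `C^k` diffeomorphism
(`IsMaximalCkAtlas.post_mem`).

Manifold morphisms compose (`IsCkMorphism.comp`) because the diffeomorphism that makes a diagram of
`f` nearly commutative can be absorbed into the chart of the middle manifold. In the new chart the
diagram of `f` commutes exactly, and the near commutativity of `g` applies to that chart. A
coordinate space records its atlas, so arrows between images come from arrows between the same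
manifolds. Hence every image is a category and every `F` a functor.

For trivial model spaces, m-compatibility is `C^k` compatibility by definition. For minimal ones,
maximality makes every open subset of a patch a patch, and every open subset of a range a range. All
sets needed are therefore model neighborhoods, and transition functions between meeting charts are
isomorphisms because they are generators. Conversely, minimality puts the coordinate morphisms
inside any competing model space, so they are `C^k` (`generated_minCoord`), and the maximal
`C^k`-atlas is a maximal m-atlas (`isMaximalMAtlas_min`). On arrows, the diffeomorphism of a nearly
commutative diagram is the restriction of a transition function, hence an isomorphism of the minimal
model space (`isIso_minCoord_of_isCkDiffeo`). -/

theorem TVSContDiffOn.continuousOn {n : ℕ} {f : V → W} {O : Set V}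
    (h : TVSContDiffOn 𝕂 n f O) : ContinuousOn f O := by
  cases n with
  | zero => exact h
  | succ n => exact h.1

theorem TVSContDiffOn.mono {n : ℕ} : ∀ {V : Type v} [AddCommGroup V] [Module 𝕂 V]
    [TopologicalSpace V] {f : V → W} {O O' : Set V},
    TVSContDiffOn 𝕂 n f O → O' ⊆ O → TVSContDiffOn 𝕂 n f O' := by
  induction n with
  | zero => intro V _ _ _ f O O' h hO; exact ContinuousOn.mono h hO
  | succ n ih =>
    intro V _ _ _ f O O' h hO
    obtain ⟨hc, q, hq, hq'⟩ := h
    exact ⟨hc.mono hO, q, fun x v t hx hxt => hq x v t (hO hx) (hO hxt),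
      ih hq' fun p hp => ⟨hO hp.1, hO hp.2⟩⟩

theorem TVSContDiffOn.of_succ {n : ℕ} : ∀ {V : Type v} [AddCommGroup V] [Module 𝕂 V]
    [TopologicalSpace V] {f : V → W} {O : Set V},
    TVSContDiffOn 𝕂 (n + 1) f O → TVSContDiffOn 𝕂 n f O := by
  induction n with
  | zero => intro V _ _ _ f O h; exact h.1
  | succ n ih =>
    intro V _ _ _ f O h
    obtain ⟨hc, q, hq, hq'⟩ := h
    exact ⟨hc, q, hq, ih hq'⟩

/-- The difference quotient of a linear map is `(x, v, t) ↦ f v`, which is linear again, so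
induction applies. -/
theorem TVSContDiffOn.of_linear {n : ℕ} : ∀ {V : Type v} [AddCommGroup V] [Module 𝕂 V]
    [TopologicalSpace V] (f : V →L[𝕂] W) (O : Set V), TVSContDiffOn 𝕂 n f O := by
  induction n with
  | zero => intro V _ _ _ f O; exact f.continuous.continuousOn
  | succ n ih =>
    intro V _ _ _ f O
    refine ⟨f.continuous.continuousOn,
      f.comp ((ContinuousLinearMap.fst 𝕂 V 𝕂).comp (ContinuousLinearMap.snd 𝕂 V (V × 𝕂))),
      fun x v t _ _ => ?_, ih _ _⟩
    simp

/-- This is the shape of the inner map in the chain rule, where the last component is the scalar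
`t`. Its difference quotient is a triple of the same shape, so the induction closes. The scalar
component is a continuous linear functional built into the statement because `𝕂` lives in `Type`,
not in the universe of the vector spaces. -/
theorem TVSContDiffOn.prodMk_linear {n : ℕ} : ∀ {V : Type v} [AddCommGroup V] [Module 𝕂 V]
    [TopologicalSpace V] {f : V → W} {g : V → Z} {O : Set V} (L : V →L[𝕂] 𝕂),
    TVSContDiffOn 𝕂 n f O → TVSContDiffOn 𝕂 n g O →
    TVSContDiffOn 𝕂 n (fun x => (f x, g x, L x)) O := by
  induction n with
  | zero =>
    intro V _ _ _ f g O L hf hg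
    exact ContinuousOn.prodMk hf (ContinuousOn.prodMk hg L.continuous.continuousOn)
  | succ n ih =>
    intro V _ _ _ f g O L hf hg
    obtain ⟨hfc, q, hq, hq'⟩ := hf
    obtain ⟨hgc, r, hr, hr'⟩ := hg
    refine ⟨hfc.prodMk (hgc.prodMk L.continuous.continuousOn), _, fun x v t hx hxt => ?_,
      ih (L.comp ((ContinuousLinearMap.fst 𝕂 V 𝕂).comp (ContinuousLinearMap.snd 𝕂 V (V × 𝕂))))
        hq' hr'⟩
    refine Prod.ext (hq x v t hx hxt) (Prod.ext (hr x v t hx hxt) ?_)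
    simp

/-- Since `f (x + t v) = f x + t q(x, v, t)`, the quotient of `g ∘ f` is `r (f x, q (x, v, t), t)`,
where `r` is that of `g`. This is a composition of maps of order `n`. The spaces are quantified
inside the induction because the domain changes to `V × V × 𝕂`. -/
theorem TVSContDiffOn.comp {n : ℕ} : ∀ {V : Type v} [AddCommGroup V] [Module 𝕂 V]
    [TopologicalSpace V] {W : Type v} [AddCommGroup W] [Module 𝕂 W] [TopologicalSpace W]
    {Z : Type v} [AddCommGroup Z] [Module 𝕂 Z] [TopologicalSpace Z]
    {g : W → Z} {f : V → W} {P : Set W} {O : Set V},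
    TVSContDiffOn 𝕂 n g P → TVSContDiffOn 𝕂 n f O → (∀ x ∈ O, f x ∈ P) →
    TVSContDiffOn 𝕂 n (fun x => g (f x)) O := by
  induction n with
  | zero => intro V _ _ _ W _ _ _ Z _ _ _ g f P O hg hf h; exact ContinuousOn.comp hg hf h
  | succ n ih =>
    intro V _ _ _ W _ _ _ Z _ _ _ g f P O hg hf h
    -- The component `f x` of the inner map is needed with order `n`, as is the quotient `q`.
    have hfn := hf.of_succ
    obtain ⟨hfc, q, hq, hq'⟩ := hf
    obtain ⟨hgc, r, hr, hr'⟩ := hg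
    have key : ∀ x v t, x ∈ O → x + t • v ∈ O → f x + t • q (x, v, t) = f (x + t • v) :=
      fun x v t hx hxt => by rw [← hq x v t hx hxt]; abel
    have hfst : TVSContDiffOn 𝕂 n (fun p : V × V × 𝕂 => f p.1)
        {p | p.1 ∈ O ∧ p.1 + p.2.2 • p.2.1 ∈ O} :=
      ih (f := fun p : V × V × 𝕂 => p.1) hfn
        (TVSContDiffOn.of_linear (ContinuousLinearMap.fst 𝕂 V (V × 𝕂)) _) fun _ hp => hp.1
    refine ⟨hgc.comp hfc h, fun p => r (f p.1, q p, p.2.2), fun x v t hx hxt => ?_,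
      ih hr' (hfst.prodMk_linear
        ((ContinuousLinearMap.snd 𝕂 V 𝕂).comp (ContinuousLinearMap.snd 𝕂 V (V × 𝕂))) hq')
        fun p hp => ?_⟩
    · have := hr (f x) (q (x, v, t)) t (h x hx) (by rw [key x v t hx hxt]; exact h _ hxt)
      rwa [key x v t hx hxt] at this
    · exact ⟨h _ hp.1, by
        have := key p.1 p.2.1 p.2.2 hp.1 hp.2
        change f p.1 + p.2.2 • q p ∈ P
        rw [show q p = q (p.1, p.2.1, p.2.2) from rfl, this]; exact h _ hp.2⟩

/-- The complex extensions compose once the first domain is shrunk to the preimage of the second,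
which is open since `F` is continuous (its case of order `0`). -/
theorem RealAnalyticOn.comp {g : W → Z} {f : V → W} {P : Set W} {O : Set V}
    (hg : RealAnalyticOn 𝕂 g P) (hf : RealAnalyticOn 𝕂 f O) (h : ∀ x ∈ O, f x ∈ P) :
    RealAnalyticOn 𝕂 (fun x => g (f x)) O := by
  intro x hx
  obtain ⟨U, F, hU, hxU, hF, hFf⟩ := hf x hx
  obtain ⟨U', G, hU', hxU', hG, hGg⟩ := hg (f x) (h x hx)
  refine ⟨U ∩ F ⁻¹' U', fun z => G (F z), (hF 0).continuousOn.isOpen_inter_preimage hU hU',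
    ⟨hxU, ?_⟩, fun n => (hG n).comp ((hF n).mono Set.inter_subset_left) fun z hz => hz.2,
    fun y hy hyU => ?_⟩
  · change F _ ∈ U'
    rwa [hFf x hx hxU]
  · have hyU' : F (Cplx.ofReal y) ∈ U' := hyU.2
    have e := hFf y hy hyU.1
    rw [e] at hyU'
    change G (F _) = _
    rw [e]
    exact hGg _ (h y hy) hyU'

theorem RealAnalyticOn.mono {f : V → W} {O O' : Set V}
    (h : RealAnalyticOn 𝕂 f O) (hO : O' ⊆ O) : RealAnalyticOn 𝕂 f O' := by
  intro x hx
  obtain ⟨U, F, hU, hxU, hF, hFf⟩ := h x (hO hx)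
  exact ⟨U, F, hU, hxU, hF, fun y hy => hFf y (hO hy)⟩

theorem RealAnalyticOn.id (O : Set V) : RealAnalyticOn 𝕂 (fun x : V => x) O := fun _ _ =>
  ⟨Set.univ, fun z => z, isOpen_univ, trivial,
    fun _ => TVSContDiffOn.of_linear (ContinuousLinearMap.id ℂ (Cplx 𝕂 V)) _, fun _ _ _ => rfl⟩

variable {k : WithTop ℕ∞}

theorem FrechetContDiffOn.comp {g : W → Z} {f : V → W} {P : Set W} {O : Set V}
    (hg : FrechetContDiffOn 𝕂 k g P) (hf : FrechetContDiffOn 𝕂 k f O) (h : ∀ x ∈ O, f x ∈ P) :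
    FrechetContDiffOn 𝕂 k (fun x => g (f x)) O :=
  ⟨fun n hn => (hg.1 n hn).comp (hf.1 n hn) h, fun hk hI => (hg.2 hk hI).comp (hf.2 hk hI) h⟩

theorem FrechetContDiffOn.mono {f : V → W} {O O' : Set V}
    (h : FrechetContDiffOn 𝕂 k f O) (hO : O' ⊆ O) : FrechetContDiffOn 𝕂 k f O' :=
  ⟨fun n hn => (h.1 n hn).mono hO, fun hk hI => (h.2 hk hI).mono hO⟩

theorem FrechetContDiffOn.id (O : Set V) : FrechetContDiffOn 𝕂 k (fun x : V => x) O :=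
  ⟨fun _ _ => TVSContDiffOn.of_linear (ContinuousLinearMap.id 𝕂 V) _,
    fun _ _ => RealAnalyticOn.id O⟩

theorem FrechetContDiffOn.continuousOn {f : V → W} {O : Set V}
    (h : FrechetContDiffOn 𝕂 k f O) : ContinuousOn f O :=
  (h.1 0 (by simp)).continuousOn

end TVS

/-! ### `C^k` maps on subspaces of Banach or Fréchet spaces -/

section Ck

variable {𝕜 : Type} [RCLike 𝕜] {σ : Setting} {k : WithTop ℕ∞}

namespace Ambient

variable {V W Z : Ambient.{v} 𝕜 σ}

theorem ContDiffOn.comp {g : W.pts → Z.pts} {f : V.pts → W.pts} {P : Set W.pts} {O : Set V.pts}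
    (hg : W.ContDiffOn k Z g P) (hf : V.ContDiffOn k W f O) (h : ∀ x ∈ O, f x ∈ P) :
    V.ContDiffOn k Z (fun x => g (f x)) O := by
  cases V <;> cases W <;> cases Z
  case banach.banach.banach V _ _ _ W _ _ _ Z _ _ _ =>
    exact _root_.ContDiffOn.comp (E := V) (F := W) (G := Z) hg hf h
  case frechet.frechet.frechet V _ _ _ _ _ _ _ W _ _ _ _ _ _ _ Z _ _ _ _ _ _ _ =>
    exact FrechetContDiffOn.comp (V := V) (W := W) (Z := Z) hg hf h

theorem ContDiffOn.mono {f : V.pts → W.pts} {O O' : Set V.pts}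
    (h : V.ContDiffOn k W f O) (hO : O' ⊆ O) : V.ContDiffOn k W f O' := by
  cases V <;> cases W
  case banach.banach V _ _ _ W _ _ _ =>
    exact _root_.ContDiffOn.mono (E := V) (F := W) h hO
  case frechet.frechet V _ _ _ _ _ _ _ W _ _ _ _ _ _ _ =>
    exact FrechetContDiffOn.mono (V := V) (W := W) h hO

theorem ContDiffOn.continuousOn {f : V.pts → W.pts} {O : Set V.pts}
    (h : V.ContDiffOn k W f O) : ContinuousOn f O := by
  cases V <;> cases W
  case banach.banach V _ _ _ W _ _ _ =>
    exact _root_.ContDiffOn.continuousOn (E := V) (F := W) h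
  case frechet.frechet V _ _ _ _ _ _ _ W _ _ _ _ _ _ _ =>
    exact FrechetContDiffOn.continuousOn (V := V) (W := W) h

theorem ContDiffOn.id (O : Set V.pts) : V.ContDiffOn k V (fun x => x) O := by
  cases V
  case banach V _ _ _ => exact contDiffOn_id (E := V)
  case frechet V _ _ _ _ _ _ _ => exact FrechetContDiffOn.id (V := V) O

end Ambient

section IsCk

variable {V W Z : Ambient.{v} 𝕜 σ} {ι κ : Type v} [TopologicalSpace ι] [TopologicalSpace κ]

/-- A local extension `F` of `e' ∘ f` sends `e i` to `e' (f i)`, where a local extension `G` of `h`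
takes the value `h (f i)`; thus `G ∘ F` extends `h ∘ f`. -/
theorem IsCk.comp {e : ι → V.pts} {f : ι → κ} {e' : κ → W.pts} {h : κ → Z.pts}
    (hh : IsCk k e' h) (hf : Continuous f) (hf' : IsCk k e fun i => e' (f i)) :
    IsCk k e fun i => h (f i) := by
  refine ⟨hh.1.comp hf, fun hk i => ?_⟩
  obtain ⟨O, F, hO, hi, hF, hFf⟩ := hf'.2 hk i
  obtain ⟨P, G, hP, hi', hG, hGh⟩ := hh.2 hk (f i)
  refine ⟨O ∩ F ⁻¹' P, fun x => G (F x), hF.continuousOn.isOpen_inter_preimage hO hP,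
    ⟨hi, ?_⟩, hG.comp (hF.mono Set.inter_subset_left) fun x hx => hx.2, fun j hj => ?_⟩
  · change F _ ∈ P
    rwa [hFf i hi]
  · have hj' : F (e j) ∈ P := hj.2
    rw [hFf j hj.1] at hj'
    change G (F (e j)) = _
    rw [hFf j hj.1, hGh _ hj']

theorem IsCk.self {e : ι → V.pts} (he : Continuous e) : IsCk k e e :=
  ⟨he, fun _ _ => ⟨Set.univ, fun x => x, isOpen_univ, trivial, Ambient.ContDiffOn.id _,
    fun _ _ => rfl⟩⟩

/-- `C^k` maps may be restricted to subspaces. -/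
theorem IsCk.restrict {e : κ → V.pts} {h : κ → W.pts} (hh : IsCk k e h) {r : ι → κ}
    (hr : Continuous r) : IsCk k (fun i => e (r i)) fun i => h (r i) := by
  refine ⟨hh.1.comp hr, fun hk i => ?_⟩
  obtain ⟨O, F, hO, hi, hF, hFf⟩ := hh.2 hk (r i)
  exact ⟨O, F, hO, hi, hF, fun j => hFf (r j)⟩

end IsCk

theorem LinearSpace.isInducing_incl (C : LinearSpace.{v} 𝕜 σ) : Topology.IsInducing C.incl :=
  Topology.IsInducing.subtypeVal

section IsCkMap

variable {C C' C'' : LinearSpace.{v} 𝕜 σ}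

theorem IsCkMap.continuous {A : Opens C.toTop} {B : Opens C'.toTop} {f : A → B}
    (hf : IsCkMap k f) : Continuous f :=
  (C'.isInducing_incl.comp Topology.IsInducing.subtypeVal).continuous_iff.2 hf.1

theorem IsCkMap.comp {A : Opens C.toTop} {B : Opens C'.toTop} {D : Opens C''.toTop}
    {g : B → D} {f : A → B} (hg : IsCkMap k g) (hf : IsCkMap k f) : IsCkMap k (g ∘ f) :=
  IsCk.comp (h := fun y : B => C''.incl (g y)) hg hf.continuous hf

theorem IsCkMap.of_eq_restrict {A A' : Opens C.toTop} {B B' : Opens C'.toTop} {f : A → B}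
    (hf : IsCkMap k f) {g : A' → B'} (hA : A' ≤ A)
    (h : ∀ x : A', (g x : C'.toTop) = f ⟨x, hA x.2⟩) : IsCkMap k g := by
  have e : (fun x : A' => C'.incl (g x)) = fun x : A' => C'.incl (f ⟨x, hA x.2⟩) :=
    funext fun x => congrArg C'.incl (h x)
  unfold IsCkMap
  rw [e]
  exact IsCk.restrict hf (continuous_inclusion hA)

theorem IsCkMap.inclusion {A A' : Opens C.toTop} (hA : A' ≤ A) :
    IsCkMap k (fun x : A' => (⟨x, hA x.2⟩ : A)) :=
  IsCk.self (C.isInducing_incl.continuous.comp continuous_subtype_val)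

theorem IsCkMap.id (A : Opens C.toTop) : IsCkMap k (_root_.id : A → A) :=
  IsCkMap.inclusion le_rfl

/-- A continuous map that is locally `C^k` is `C^k`. -/
theorem IsCkMap.of_locally {A : Opens C.toTop} {B : Opens C'.toTop} {g : A → B}
    (hg : Continuous g) (h : ∀ x : A, ∃ (U : Opens C.toTop) (V : Opens C'.toTop) (f : U → V),
      (x : C.toTop) ∈ U ∧ IsCkMap k f ∧
        ∀ (y : U) (hy : (y : C.toTop) ∈ A), (g ⟨y, hy⟩ : C'.toTop) = f y) : IsCkMap k g := by
  refine ⟨C'.isInducing_incl.continuous.comp (continuous_subtype_val.comp hg), fun hk x => ?_⟩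
  obtain ⟨U, V, f, hx, hf, hfg⟩ := h x
  obtain ⟨O, G, hO, hxO, hG, hGf⟩ := hf.2 hk ⟨x, hx⟩
  -- `G` is only known to agree with `f` over `U`. Intersecting with an ambient open set whose trace
  -- on `C` is `U` excludes the points of `A` outside `U`.
  obtain ⟨P, hP, hPU⟩ := C.isInducing_incl.isOpen_iff.1 U.isOpen
  have hmem : ∀ y, C.incl y ∈ P ↔ y ∈ U := fun y => Set.ext_iff.1 hPU y
  refine ⟨O ∩ P, G, hO.inter hP, ⟨hxO, (hmem _).2 hx⟩, hG.mono Set.inter_subset_left,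
    fun y hy => ?_⟩
  have hyU : (y : C.toTop) ∈ U := (hmem _).1 hy.2
  exact (hGf ⟨y, hyU⟩ hy.1).trans (congrArg C'.incl (hfg ⟨y, hyU⟩ y.2).symm)

end IsCkMap

end Ck

/-! ## Charts -/

section Charts

variable {X : Type u} [TopologicalSpace X] {Y : Type v} [TopologicalSpace Y]

namespace Chart

theorem mem_image {c : Chart X Y} {W : Opens X} {y : Y} :
    y ∈ c.image W ↔ ∃ h : y ∈ c.V, (c.φ.symm ⟨y, h⟩ : X) ∈ W := by
  constructor
  · rintro ⟨_, ⟨x, hx, rfl⟩, rfl⟩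
    exact ⟨(c.φ x).2, by simpa using hx⟩
  · rintro ⟨h, hW⟩
    exact ⟨_, ⟨c.φ.symm ⟨y, h⟩, hW, rfl⟩, by simp⟩

theorem φ_mem_image {c : Chart X Y} {W : Opens X} {x : X} (hx : x ∈ c.U) (hW : x ∈ W) :
    (c.φ ⟨x, hx⟩ : Y) ∈ c.image W :=
  mem_image.2 ⟨(c.φ ⟨x, hx⟩).2, by simpa using hW⟩

theorem image_le (c : Chart X Y) (W : Opens X) : c.image W ≤ c.V := fun _ hy => (mem_image.1 hy).1

theorem mem_symm_image {c : Chart X Y} {W : Opens Y} {x : X} :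
    x ∈ c.symm.image W ↔ ∃ h : x ∈ c.U, (c.φ ⟨x, h⟩ : Y) ∈ W :=
  mem_image

theorem symm_image_image {c : Chart X Y} {W : Opens X} (hW : W ≤ c.U) :
    c.symm.image (c.image W) = W := by
  ext x
  refine ⟨fun hx => ?_, fun hx => mem_symm_image.2 ⟨hW hx, φ_mem_image _ hx⟩⟩
  obtain ⟨h, hx⟩ := mem_symm_image.1 hx
  obtain ⟨h', hx⟩ := mem_image.1 hx
  simpa using hx

/-- The transition function of two charts. -/
def trans (c c' : Chart X Y) : c.image c'.U ≃ c'.image c.U where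
  toFun y := ⟨c'.φ ⟨c.φ.symm ⟨y, (mem_image.1 y.2).1⟩, (mem_image.1 y.2).2⟩,
    φ_mem_image _ (c.φ.symm _).2⟩
  invFun y := ⟨c.φ ⟨c'.φ.symm ⟨y, (mem_image.1 y.2).1⟩, (mem_image.1 y.2).2⟩,
    φ_mem_image _ (c'.φ.symm _).2⟩
  left_inv y := by simp
  right_inv y := by simp

theorem isTransition_trans (c c' : Chart X Y) : IsTransition c c' (c.trans c') := by
  intro x hx hx' hy
  simp [trans]

end Chart

theorem IsTransition.apply_eq {c c' : Chart X Y} {t : c.image c'.U → c'.image c.U}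
    (ht : IsTransition c c' t) (y : Y) (hV : y ∈ c.V) (hU : (c.φ.symm ⟨y, hV⟩ : X) ∈ c'.U) :
    (t ⟨y, Chart.mem_image.2 ⟨hV, hU⟩⟩ : Y) = c'.φ ⟨c.φ.symm ⟨y, hV⟩, hU⟩ := by
  have := ht _ (c.φ.symm ⟨y, hV⟩).2 hU (Chart.φ_mem_image _ hU)
  simpa using this

/-- Every point of `φ[U ∩ U']` is the coordinate of a point of both patches, so a transition
function has no freedom. The existential in the compatibility conditions may thus be replaced by
`Chart.trans`. -/
theorem IsTransition.eq_trans {c c' : Chart X Y} {t : c.image c'.U → c'.image c.U}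
    (ht : IsTransition c c' t) : t = c.trans c' := by
  funext y
  obtain ⟨hV, hU⟩ := Chart.mem_image.1 y.2
  exact Subtype.ext (ht.apply_eq y hV hU)

theorem IsTransition.equiv_eq_trans {c c' : Chart X Y} {t : c.image c'.U ≃ c'.image c.U}
    (ht : IsTransition c c' t) : t = c.trans c' :=
  DFunLike.coe_injective ht.eq_trans

/-- The composition of the restriction of a chart with a homeomorphism of its range. -/
def Chart.post (c : Chart X Y) {V₂ Vh : Opens Y} (hV : V₂ ≤ c.V) (e : V₂ ≃ₜ Vh) : Chart X Y where
  U := c.symm.image V₂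
  V := Vh
  φ :=
    { toFun x := e ⟨c.φ ⟨x, (mem_symm_image.1 x.2).1⟩, (mem_symm_image.1 x.2).2⟩
      invFun y := ⟨c.φ.symm ⟨e.symm y, hV (e.symm y).2⟩,
        mem_symm_image.2 ⟨(c.φ.symm _).2, by simp⟩⟩
      left_inv x := by simp
      right_inv y := by simp
      continuous_toFun := by fun_prop
      continuous_invFun := by fun_prop }

end Charts

/-! ### Closure properties of maximal `C^k`-atlases -/

section CkAtlases

variable {𝕜 : Type} [RCLike 𝕜] {σ : Setting} {k : WithTop ℕ∞}

/-- The homeomorphism given by a `C^k` diffeomorphism. -/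
def IsCkDiffeo.homeomorph {C : LinearSpace.{v} 𝕜 σ} {A B : Opens C.toTop} {e : A ≃ B}
    (he : IsCkDiffeo k e) : A ≃ₜ B where
  toEquiv := e
  continuous_toFun := he.1.continuous
  continuous_invFun := he.2.continuous

theorem isCkMap_of_isEmpty {C C' : LinearSpace.{v} 𝕜 σ} {A : Opens C.toTop} {B : Opens C'.toTop}
    (f : A → B) (hA : ∀ x, x ∉ A) : IsCkMap k f :=
  ⟨continuous_iff_continuousAt.2 fun x => (hA _ x.2).elim, fun _ x => (hA _ x.2).elim⟩

/-- The alternative of disjoint patches is absorbed: the transition function then has empty domain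
and is vacuously `C^k`. -/
theorem ckCompatible_iff {E : TopCat.{u}} {C : LinearSpace.{v} 𝕜 σ} {c c' : Chart E C.toTop} :
    CkCompatible k c c' ↔ IsCkDiffeo k (c.trans c') := by
  constructor
  · rintro (h | ⟨t, ht, htk⟩)
    · have key : ∀ x, x ∈ c.U → x ∉ c'.U := fun x hx hx' =>
        (disjoint_iff.1 h ▸ (⟨hx, hx'⟩ : x ∈ c.U ⊓ c'.U) : x ∈ (⊥ : Opens E))
      exact ⟨isCkMap_of_isEmpty _ fun y hy => by
          obtain ⟨hV, hU⟩ := Chart.mem_image.1 hy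
          exact key _ (c.φ.symm ⟨y, hV⟩).2 hU,
        isCkMap_of_isEmpty _ fun y hy => by
          obtain ⟨hV, hU⟩ := Chart.mem_image.1 hy
          exact key _ hU (c'.φ.symm ⟨y, hV⟩).2⟩
    · exact ht.equiv_eq_trans ▸ htk
  · exact fun h => Or.inr ⟨_, Chart.isTransition_trans c c', h⟩

namespace IsMaximalCkAtlas

variable {T : AtlasTriple.{u, v} 𝕜 σ}

theorem isCkDiffeo_trans (hT : IsMaximalCkAtlas k T) {c c' : Chart T.E T.C.toTop} (hc : c ∈ T.A)
    (hc' : c' ∈ T.A) : IsCkDiffeo k (c.trans c') :=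
  ckCompatible_iff.1 (hT.1.compatible c hc c' hc')

/-- The transition from the new chart to a chart `d` is `e⁻¹` followed by the one from `c` to `d`,
and the inverse is the one from `d` to `c` followed by `e`, each on a smaller domain. So the new
chart is compatible with the whole atlas, and maximality applies. -/
theorem post_mem (hT : IsMaximalCkAtlas k T) {c : Chart T.E T.C.toTop} (hc : c ∈ T.A)
    {V₂ Vh : Opens T.C.toTop} (hV : V₂ ≤ c.V) {e : V₂ ≃ Vh} (he : IsCkDiffeo k e) :
    c.post hV he.homeomorph ∈ T.A := by
  refine hT.2 _ fun d hd => ckCompatible_iff.2 ?_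
  obtain ⟨h₁, h₂⟩ := hT.isCkDiffeo_trans hc hd
  have hW : ∀ y : (c.post hV he.homeomorph).image d.U, (y : T.C.toTop) ∈ Vh :=
    fun y => Chart.image_le _ _ y.2
  have hW' : ∀ y : (c.post hV he.homeomorph).image d.U,
      (e.symm ⟨y, hW y⟩ : T.C.toTop) ∈ c.image d.U := fun y =>
    Chart.mem_image.2 ⟨hV (e.symm _).2, (Chart.mem_image.1 y.2).2⟩
  have hd' : d.image (c.post hV he.homeomorph).U ≤ d.image c.U := fun y hy => by
    obtain ⟨hy, hy'⟩ := Chart.mem_image.1 hy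
    exact Chart.mem_image.2 ⟨hy, (Chart.mem_symm_image.1 hy').1⟩
  have hd'' : ∀ y : d.image (c.post hV he.homeomorph).U,
      (d.trans c ⟨y, hd' y.2⟩ : T.C.toTop) ∈ V₂ := fun y => by
    obtain ⟨hy, hy'⟩ := Chart.mem_image.1 y.2
    exact (Chart.mem_symm_image.1 hy').2
  constructor
  · have hs : IsCkMap k (fun y : (c.post hV he.homeomorph).image d.U =>
        (⟨e.symm ⟨y, hW y⟩, hW' y⟩ : c.image d.U)) :=
      he.2.of_eq_restrict (Chart.image_le _ _) fun _ => rfl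
    exact (h₁.comp hs).of_eq_restrict le_rfl fun y => rfl
  · have hs : IsCkMap k (fun y : d.image (c.post hV he.homeomorph).U =>
        (⟨d.trans c ⟨y, hd' y.2⟩, hd'' y⟩ : V₂)) :=
      IsCkMap.of_eq_restrict h₂ hd' fun _ => rfl
    exact (he.1.comp hs).of_eq_restrict le_rfl fun y => rfl

/-- Composing with the identity of `V` restricts the chart. Together with the analogue for patches,
this makes all open subsets of patches and ranges neighborhoods of the minimal model spaces. -/
theorem exists_chart_range_eq (hT : IsMaximalCkAtlas k T) {c : Chart T.E T.C.toTop}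
    (hc : c ∈ T.A) {V : Opens T.C.toTop} (hV : V ≤ c.V) : ∃ d ∈ T.A, d.V = V :=
  ⟨_, hT.post_mem hc hV (e := Equiv.refl V) ⟨IsCkMap.id V, IsCkMap.id V⟩, rfl⟩

theorem exists_chart_patch_eq (hT : IsMaximalCkAtlas k T) {c : Chart T.E T.C.toTop}
    (hc : c ∈ T.A) {U : Opens T.E} (hU : U ≤ c.U) : ∃ d ∈ T.A, d.U = U :=
  ⟨_, hT.post_mem hc (Chart.image_le c U) (e := Equiv.refl _) ⟨IsCkMap.id _, IsCkMap.id _⟩,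
    Chart.symm_image_image hU⟩

end IsMaximalCkAtlas

/-! ## The category of manifolds -/

theorem IsCk.continuous_of_incl {C C' : LinearSpace.{v} 𝕜 σ} {f : C.toTop → C'.toTop}
    (hf : IsCk k C.incl fun y => C'.incl (f y)) : Continuous f :=
  C'.isInducing_incl.continuous_iff.2 hf.1

theorem IsMaximalCkAtlas.isCkMorphism_id {T : AtlasTriple.{u, v} 𝕜 σ}
    (hT : IsMaximalCkAtlas k T) : IsCkMorphism k T T (id, id) where
  continuous := continuous_id
  ck := IsCk.self T.C.isInducing_incl.continuous
  nearlyComm c hc c' hc' x hx hx' := by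
    -- Two charts at the same point differ by a coordinate change, so the diagram of the identity
    -- commutes after inserting the transition from `c'` back to `c`.
    refine ⟨c.U ⊓ c'.U, c.image c'.U, c.U ⊓ c'.U, c'.image c.U, c.image c'.U, c'.trans c,
      hT.isCkDiffeo_trans hc' hc, ?_⟩
    exact
      { U₁_le := inf_le_left
        U₁_sub := fun z hz => hz.2
        V₁_le := Chart.image_le _ _
        U₂_le := inf_le_right
        V₂_le := Chart.image_le _ _
        x_mem := ⟨hx, hx'⟩
        fx_mem := fun hx => Chart.φ_mem_image _ hx'
        f₀_image := fun z hz => hz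
        φ_image := fun z hz hz' => Chart.φ_mem_image _ hz'.2
        f₁_image := fun y hy => hy
        φ'_image := fun z hz hz' => Chart.φ_mem_image _ hz'.1
        comm := fun z hz hz' hV _ => Chart.isTransition_trans c' c z hz' hz hV }

theorem IsCkMorphism.comp {T T' T'' : AtlasTriple.{u, v} 𝕜 σ} (hT' : IsMaximalCkAtlas k T')
    {f : FunPair T T'} {g : FunPair T' T''} (hg : IsCkMorphism k T' T'' g)
    (hf : IsCkMorphism k T T' f) : IsCkMorphism k T T'' (g.1 ∘ f.1, g.2 ∘ f.2) where
  continuous := hg.continuous.comp hf.continuous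
  ck := IsCk.comp (h := fun y => T''.C.incl (g.2 y)) hg.ck hf.ck.continuous_of_incl hf.ck
  nearlyComm c hc c'' hc'' x hx hx'' := by
    obtain ⟨c', hc', hx'⟩ := hT'.1.cover (f.1 x)
    obtain ⟨U₁, V₁, U₂, V₂, Vh, fh, hfh, Hf⟩ := hf.nearlyComm c hc c' hc' x hx hx'
    -- The diffeomorphism `fh` is absorbed into the middle chart `c'`.
    have hd := hT'.post_mem hc' Hf.V₂_le hfh
    have hU₂ : ∀ z (hz : z ∈ U₂), (c'.φ ⟨z, Hf.U₂_le hz⟩ : T'.C.toTop) ∈ V₂ :=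
      fun z hz => Hf.φ'_image _ _ hz
    have hdU : ∀ z ∈ U₂, z ∈ (c'.post Hf.V₂_le hfh.homeomorph).U :=
      fun z hz => Chart.mem_symm_image.2 ⟨Hf.U₂_le hz, hU₂ z hz⟩
    -- In the new chart the diagram of `f` commutes exactly: the coordinate of `f.1 z` is the image
    -- under `f.2` of the coordinate of `z`.
    have hdφ : ∀ z (hz : z ∈ U₁),
        ((c'.post Hf.V₂_le hfh.homeomorph).φ ⟨f.1 z, hdU _ (Hf.f₀_image z hz)⟩ : T'.C.toTop) =
          f.2 (c.φ ⟨z, Hf.U₁_le hz⟩) := fun z hz =>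
      Hf.comm z (Hf.U₁_le hz) (Hf.U₁_sub z hz) (hU₂ _ (Hf.f₀_image z hz)) hz
    obtain ⟨W₁, Y₁, W₂, Y₂, Yh, gh, hgh, Hg⟩ :=
      hg.nearlyComm _ hd c'' hc'' (f.1 x) (hdU _ (Hf.f₀_image x Hf.x_mem)) hx''
    have hcf := hf.ck.continuous_of_incl
    have hxW : f.1 x ∈ W₁ := Hg.x_mem
    refine ⟨U₁ ⊓ ⟨f.1 ⁻¹' W₁, W₁.isOpen.preimage hf.continuous⟩,
      V₁ ⊓ ⟨f.2 ⁻¹' Y₁, Y₁.isOpen.preimage hcf⟩, W₂, Y₂, Yh, gh, hgh, ?_⟩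
    have hφ : ∀ (z : T.E) (hz : z ∈ c.U), z ∈ U₁ → f.1 z ∈ W₁ → f.2 (c.φ ⟨z, hz⟩) ∈ Y₁ :=
      fun z hz hz₁ hz₂ => by
        rw [← hdφ z hz₁]
        exact Hg.φ_image _ _ hz₂
    exact
      { U₁_le := inf_le_left.trans Hf.U₁_le
        U₁_sub := fun z hz => Hg.U₁_sub _ hz.2
        V₁_le := inf_le_left.trans Hf.V₁_le
        U₂_le := Hg.U₂_le
        V₂_le := Hg.V₂_le
        x_mem := ⟨Hf.x_mem, hxW⟩
        fx_mem := fun hx => Hg.f₁_image _ (hφ x hx Hf.x_mem hxW)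
        f₀_image := fun z hz => Hg.f₀_image _ hz.2
        φ_image := fun z hz hz' => ⟨Hf.φ_image z hz hz'.1, hφ z hz hz'.1 hz'.2⟩
        f₁_image := fun y hy => Hg.f₁_image _ hy.2
        φ'_image := Hg.φ'_image
        comm := fun z hz hz' hV hzU => by
          refine (Hg.comm (f.1 z) (hdU _ (Hf.f₀_image z hzU.1)) hz' hV hzU.2).trans ?_
          rw [hdφ z hzU.1]
          rfl }

theorem manCk_isCategory (k : WithTop ℕ∞) (Es : Set TopCat.{u}) (Cs : Set (LinearSpace.{v} 𝕜 σ)) :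
    (manCk k Es Cs).IsCategory where
  dom_mem _ _ _ hf := ⟨hf.1.1, hf.1.2, hf.2.2.1⟩
  cod_mem _ _ _ hf := ⟨hf.2.1.1, hf.2.1.2, hf.2.2.2.1⟩
  id_mem _ hT := ⟨⟨hT.1, hT.2.1⟩, ⟨hT.1, hT.2.1⟩, hT.2.2, hT.2.2, hT.2.2.isCkMorphism_id⟩
  comp_mem _ _ _ _ hf _ hg := ⟨hf.1, hg.2.1, hf.2.2.1, hg.2.2.2.1,
    IsCkMorphism.comp hg.2.2.1 hg.2.2.2.2 hf.2.2.2.2⟩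
  id_comp _ _ _ _ := rfl
  comp_id _ _ _ _ := rfl
  assoc _ _ _ _ _ _ _ _ _ _ := rfl

/-- A coordinate space contains its atlas, so `T ↦ F T` is injective. Arrows that are composable in
the image then come from arrows composable among manifolds, and the image is closed under
composition. -/
theorem lcsArrow_iff {Es : Set TopCat.{u}} {Cs : Set (LinearSpace.{v} 𝕜 σ)}
    {D : DataFun.{u, v} 𝕜 σ} {L L' : LCS2.{u, v} 𝕜 σ} {f : FunPair L.base L'.base} :
    LCSArrow k Es Cs D L L' f ↔
      L = D.toLCS L.base ∧ L' = D.toLCS L'.base ∧ f ∈ (manCk k Es Cs).Ar L.base L'.base := by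
  constructor
  · rintro ⟨T, T', f, hf⟩
    exact ⟨rfl, rfl, hf⟩
  · obtain ⟨T, d⟩ := L
    obtain ⟨T', d'⟩ := L'
    rintro ⟨h, h', hf⟩
    obtain rfl : d = D T := by injection h
    obtain rfl : d' = D T' := by injection h'
    exact .mk T T' f hf

theorem lcsCat_isCategory (k : WithTop ℕ∞) (Es : Set TopCat.{u}) (Cs : Set (LinearSpace.{v} 𝕜 σ))
    (D : DataFun.{u, v} 𝕜 σ) : (lcsCat k Es Cs D).IsCategory where
  dom_mem _ _ _ hf :=
    have h := lcsArrow_iff.1 hf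
    ⟨_, (manCk_isCategory k Es Cs).dom_mem _ _ _ h.2.2, h.1⟩
  cod_mem _ _ _ hf :=
    have h := lcsArrow_iff.1 hf
    ⟨_, (manCk_isCategory k Es Cs).cod_mem _ _ _ h.2.2, h.2.1⟩
  id_mem := by
    rintro _ ⟨T, hT, rfl⟩
    exact .mk T T _ ((manCk_isCategory k Es Cs).id_mem T hT)
  comp_mem _ _ _ _ hf _ hg :=
    have h := lcsArrow_iff.1 hf
    have h' := lcsArrow_iff.1 hg
    lcsArrow_iff.2 ⟨h.1, h'.2.1, (manCk_isCategory k Es Cs).comp_mem _ _ _ _ h.2.2 _ h'.2.2⟩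
  id_comp _ _ _ _ := rfl
  comp_id _ _ _ _ := rfl
  assoc _ _ _ _ _ _ _ _ _ _ := rfl

theorem isManFunctor (k : WithTop ℕ∞) (Es : Set TopCat.{u}) (Cs : Set (LinearSpace.{v} 𝕜 σ))
    (D : DataFun.{u, v} 𝕜 σ) : IsManFunctor k Es Cs D where
  source := manCk_isCategory k Es Cs
  target := lcsCat_isCategory k Es Cs D
  obj_mem T hT := ⟨T, hT, rfl⟩
  map_mem T T' f hf := .mk T T' f hf
  map_id _ _ := rfl
  map_comp _ _ _ _ _ _ _ := rfl

end CkAtlases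

/-! ## Trivial and minimal model spaces -/

namespace ModelSpace

variable {X : Type u} [TopologicalSpace X]

theorem isModelSpace_triv : (triv X).IsModelSpace where
  cover := top_unique (le_sSup (Set.mem_univ _))
  inter _ _ _ _ := trivial
  dom_mem _ _ _ _ := trivial
  cod_mem _ _ _ _ := trivial
  id_mem _ _ := continuous_id
  comp_mem _ _ _ _ _ hf hg := Continuous.comp hg hf
  continuous _ _ _ hf := hf
  restrict A B A' B' f g hA hf _ _ _ h := by
    refine continuous_induced_rng.2 ?_
    have e : Subtype.val ∘ g = fun x : A' => (f ⟨x, hA x.2⟩ : X) := funext h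
    rw [e]
    exact continuous_subtype_val.comp (Continuous.comp hf (continuous_inclusion hA))
  inclusion _ _ hA _ _ := continuous_inclusion hA
  sheaf _ _ _ _ _ _ _ _ _ _ _ _ hg _ := hg

/-- The model neighborhoods that are contained in `S`, and all functions of the model space between
them. -/
def below (M : ModelSpace X) (S : Opens X) : ModelSpace X where
  S := S
  Ob := {A | A ∈ M.Ob ∧ A ≤ S}
  Hom A B := {f | f ∈ M.Hom A B ∧ A ≤ S ∧ B ≤ S}

theorem IsModelSpace.below {M : ModelSpace X} (hM : M.IsModelSpace) {S : Opens X}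
    (hS : S ∈ M.Ob) : (M.below S).IsModelSpace where
  cover := le_antisymm (sSup_le fun _ hA => hA.2) (le_sSup ⟨hS, le_rfl⟩)
  inter A hA B hB := ⟨hM.inter A hA.1 B hB.1, inf_le_left.trans hA.2⟩
  dom_mem A B f hf := ⟨hM.dom_mem A B f hf.1, hf.2.1⟩
  cod_mem A B f hf := ⟨hM.cod_mem A B f hf.1, hf.2.2⟩
  id_mem A hA := ⟨hM.id_mem A hA.1, hA.2, hA.2⟩
  comp_mem A B D f g hf hg := ⟨hM.comp_mem A B D f g hf.1 hg.1, hf.2.1, hg.2.2⟩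
  continuous A B f hf := hM.continuous A B f hf.1
  restrict A B A' B' f g hA hf hA' hB' hB h :=
    ⟨hM.restrict A B A' B' f g hA hf.1 hA'.1 hB'.1 hB h, hA'.2, hB'.2⟩
  inclusion A' A hA hA' hA'' := ⟨hM.inclusion A' A hA hA'.1 hA''.1, hA'.2, hA''.2⟩
  sheaf ι U V f hf A B hA hB hAU hBV g hg h :=
    ⟨hM.sheaf ι U V f (fun i => (hf i).1) A B hA.1 hB.1 hAU hBV g hg h, hA.2, hB.2⟩

/-- `N` is a model space on `⋃ O` with the neighborhoods `O` and the functions `F`. -/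
structure Generated (O : Set (Opens X)) (F : ∀ A B : Opens X, Set (A → B)) (N : ModelSpace X) :
    Prop where
  isModelSpace : N.IsModelSpace
  space : N.S = sSup O
  ob : O ⊆ N.Ob
  hom : ∀ A B, F A B ⊆ N.Hom A B

section Minimal

variable {O : Set (Opens X)} {F : ∀ A B : Opens X, Set (A → B)} {N : ModelSpace X}

theorem Generated.minimal_ob (hN : Generated O F N) : (minimal O F).Ob ⊆ N.Ob :=
  fun _ hA => hA N hN.1 hN.2 hN.3 hN.4

theorem Generated.minimal_hom (hN : Generated O F N) (A B : Opens X) :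
    (minimal O F).Hom A B ⊆ N.Hom A B :=
  fun _ hf => hf N hN.1 hN.2 hN.3 hN.4

theorem mem_minimal_ob {A : Opens X} (hA : A ∈ O) : A ∈ (minimal O F).Ob :=
  fun _ _ _ hO _ => hO hA

theorem mem_minimal_hom {A B : Opens X} {f : A → B} (hf : f ∈ F A B) :
    f ∈ (minimal O F).Hom A B :=
  fun _ _ _ _ hF => hF A B hf

/-- Most of the conditions pass to intersections of model spaces. One actual competitor `N` is
needed for the upper bound on the neighborhoods and for continuity, which an intersection over an
empty family would not give. -/
theorem Generated.isModelSpace_minimal (hN : Generated O F N) : (minimal O F).IsModelSpace where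
  cover := le_antisymm
    ((sSup_le_sSup hN.minimal_ob).trans (hN.isModelSpace.cover.trans hN.space).le)
    (sSup_le_sSup fun _ => mem_minimal_ob)
  inter A hA B hB N h₁ h₂ h₃ h₄ := h₁.inter A (hA N h₁ h₂ h₃ h₄) B (hB N h₁ h₂ h₃ h₄)
  dom_mem A B f hf N h₁ h₂ h₃ h₄ := h₁.dom_mem A B f (hf N h₁ h₂ h₃ h₄)
  cod_mem A B f hf N h₁ h₂ h₃ h₄ := h₁.cod_mem A B f (hf N h₁ h₂ h₃ h₄)
  id_mem A hA N h₁ h₂ h₃ h₄ := h₁.id_mem A (hA N h₁ h₂ h₃ h₄)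
  comp_mem A B D f g hf hg N h₁ h₂ h₃ h₄ :=
    h₁.comp_mem A B D f g (hf N h₁ h₂ h₃ h₄) (hg N h₁ h₂ h₃ h₄)
  continuous A B f hf := hN.isModelSpace.continuous A B f (hN.minimal_hom A B hf)
  restrict A B A' B' f g hA hf hA' hB' hB h N h₁ h₂ h₃ h₄ :=
    h₁.restrict A B A' B' f g hA (hf N h₁ h₂ h₃ h₄) (hA' N h₁ h₂ h₃ h₄) (hB' N h₁ h₂ h₃ h₄) hB h
  inclusion A' A hA hA' hA'' N h₁ h₂ h₃ h₄ :=
    h₁.inclusion A' A hA (hA' N h₁ h₂ h₃ h₄) (hA'' N h₁ h₂ h₃ h₄)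
  sheaf ι U V f hf A B hA hB hAU hBV g hg h N h₁ h₂ h₃ h₄ :=
    h₁.sheaf ι U V f (fun i => hf i N h₁ h₂ h₃ h₄) A B (hA N h₁ h₂ h₃ h₄) (hB N h₁ h₂ h₃ h₄)
      hAU hBV g hg h

end Minimal

/-! ## Model functions and singleton categories -/

theorem IsModelSpace.le_space {M : ModelSpace X} (hM : M.IsModelSpace) {A : Opens X}
    (hA : A ∈ M.Ob) : A ≤ M.S :=
  hM.cover ▸ le_sSup hA

theorem IsModelSpace.isModelFunction_id {M : ModelSpace X} (hM : M.IsModelSpace) :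
    M.IsModelFunction M id :=
  ⟨continuous_id, fun V hV => ⟨V, hV, fun _ => ⟨fun hx => ⟨hM.le_space hV hx, hx⟩, fun h => h.2⟩⟩,
    fun U hU => ⟨U, hU, fun _ hx => hx⟩⟩

variable {Y : Type v} [TopologicalSpace Y] {Z : Type w} [TopologicalSpace Z]

theorem IsModelFunction.comp {M : ModelSpace X} {N : ModelSpace Y} {Q : ModelSpace Z}
    {g : N.S → Q.S} {f : M.S → N.S} (hg : N.IsModelFunction Q g) (hf : M.IsModelFunction N f) :
    M.IsModelFunction Q (g ∘ f) := by
  refine ⟨hg.1.comp hf.1, fun V hV => ?_, fun U hU => ?_⟩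
  · obtain ⟨W, hW, hWV⟩ := hg.2.1 V hV
    obtain ⟨U, hU, hUW⟩ := hf.2.1 W hW
    refine ⟨U, hU, fun x => ⟨fun hx => ?_, fun ⟨hx, hxV⟩ => ?_⟩⟩
    · obtain ⟨hx, hxW⟩ := (hUW x).1 hx
      exact ⟨hx, ((hWV _).1 hxW).2⟩
    · exact (hUW x).2 ⟨hx, (hWV _).2 ⟨(f ⟨x, hx⟩).2, hxV⟩⟩
  · obtain ⟨V, hV, hUV⟩ := hf.2.2 U hU
    obtain ⟨W, hW, hVW⟩ := hg.2.2 V hV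
    exact ⟨W, hW, fun x hx => hVW _ (hUV x hx)⟩

/-- When all open sets are neighborhoods, inverse images are neighborhoods by continuity, and the
whole space contains every image. -/
theorem isModelFunction_of_continuous {M : ModelSpace X} {N : ModelSpace Y}
    (hM : ∀ A, A ∈ M.Ob) (hN : ∀ A, A ∈ N.Ob) {g : M.S → N.S} (hg : Continuous g) :
    M.IsModelFunction N g := by
  refine ⟨hg, fun V _ => ⟨⟨Subtype.val '' {x : M.S | (g x : Y) ∈ V},
    M.S.isOpen.isOpenMap_subtype_val _ (V.isOpen.preimage (continuous_subtype_val.comp hg))⟩,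
    hM _, fun x => ?_⟩, fun _ _ => ⟨⊤, hN _, fun _ _ => trivial⟩⟩
  exact ⟨fun ⟨y, hy, e⟩ => e ▸ ⟨y.2, hy⟩, fun ⟨hx, hxV⟩ => ⟨⟨x, hx⟩, hxV, rfl⟩⟩

theorem IsModelSpace.isLocallyMorphism_id {M : ModelSpace X} (hM : M.IsModelSpace) :
    M.IsLocallyMorphism id := by
  intro u
  obtain ⟨U, hU, hu⟩ := Opens.mem_sSup.1 (hM.cover.symm ▸ u.2 : (u : X) ∈ sSup M.Ob)
  exact ⟨U, U, id, hu, hM.id_mem U hU, fun _ _ => rfl⟩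

/-- The local representatives `φ : U → V` of `f` and `ψ : U' → V'` of `g` are composed through `V ⊓
U'`. The inverse image of this set under `f` is a model neighborhood because `f` is a model
function, so both can be restricted within the category. -/
theorem IsLocallyMorphism.comp {M : ModelSpace X} (hM : M.IsModelSpace) {f g : M.S → M.S}
    (hg : M.IsLocallyMorphism g) (hf : M.IsLocallyMorphism f) (hf' : M.IsModelFunction M f) :
    M.IsLocallyMorphism (g ∘ f) := by
  intro u
  obtain ⟨U, V, φ, hu, hφ, hfφ⟩ := hf u
  obtain ⟨U', V', ψ, hu', hψ, hgψ⟩ := hg (f u)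
  have hV := hM.cod_mem _ _ _ hφ
  have hU' := hM.dom_mem _ _ _ hψ
  have hVU' := hM.inter V hV U' hU'
  obtain ⟨W, hW, hWf⟩ := hf'.2.1 _ hVU'
  have hUW := hM.inter U (hM.dom_mem _ _ _ hφ) W hW
  have hfu : (f u : X) ∈ V := hfφ ⟨u, hu⟩ u.2 ▸ (φ ⟨u, hu⟩).2
  have hmem : ∀ x (hx : x ∈ U ⊓ W), (φ ⟨x, hx.1⟩ : X) ∈ V ⊓ U' := fun x hx => by
    obtain ⟨hxS, hxV⟩ := (hWf x).1 hx.2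
    rwa [← hfφ ⟨x, hx.1⟩ hxS]
  have h₁ : (fun x : ↥(U ⊓ W) => (⟨φ ⟨x, x.2.1⟩, hmem x x.2⟩ : ↥(V ⊓ U'))) ∈ M.Hom _ _ :=
    hM.restrict U V _ _ φ _ inf_le_left hφ hUW hVU' inf_le_left fun _ => rfl
  have h₂ : (fun x : ↥(V ⊓ U') => ψ ⟨x, x.2.2⟩) ∈ M.Hom _ _ :=
    hM.restrict U' V' _ _ ψ _ inf_le_right hψ hVU' (hM.cod_mem _ _ _ hψ) le_rfl fun _ => rfl
  refine ⟨U ⊓ W, V', _, ⟨hu, (hWf u).2 ⟨u.2, hfu, hu'⟩⟩, hM.comp_mem _ _ _ _ _ h₁ h₂, fun x hx => ?_⟩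
  have e := hfφ ⟨x, x.2.1⟩ hx
  have hx' : (f ⟨x, hx⟩ : X) ∈ U' := by rw [e]; exact (hmem x x.2).2
  refine (hgψ ⟨f ⟨x, hx⟩, hx'⟩ (f ⟨x, hx⟩).2).trans ?_
  exact congrArg (fun y => (ψ y : X)) (Subtype.ext e)

end ModelSpace

theorem SpaceCat.isModelCategory_sing {𝔖 : Type w} {P : 𝔖 → TopCat.{u}}
    (M : Σ s, ModelSpace (P s)) (hM : M.2.IsModelSpace) : (SpaceCat.sing M).IsModelCategory where
  isModelSpace := by rintro _ rfl; exact hM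
  dom_mem := by rintro _ _ _ ⟨⟩; rfl
  cod_mem := by rintro _ _ _ ⟨⟩; rfl
  isModelFunction := by rintro _ _ _ ⟨f, hf, _⟩; exact hf
  id_mem := by rintro _ rfl; exact .mk _ hM.isModelFunction_id hM.isLocallyMorphism_id
  comp_mem := by
    rintro _ _ _ _ ⟨f, hf, hf'⟩ _ ⟨g, hg, hg'⟩
    exact .mk _ (hg.comp hf) (hg'.comp hM hf' hf)

/-! ### Model spaces and model categories of `C^k` maps -/

section CkAtlases

variable {𝕜 : Type} [RCLike 𝕜] {σ : Setting} {k : WithTop ℕ∞}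

theorem isModelCategory_singCk (M : Σ C : LinearSpace.{v} 𝕜 σ, ModelSpace C.toTop)
    (hM : M.2.IsModelSpace) : (singCk k M).IsModelCategory where
  isModelSpace := by rintro _ rfl; exact hM
  dom_mem _ _ _ hf := hf.1
  cod_mem _ _ _ hf := hf.2.1
  isModelFunction _ _ _ hf := hf.2.2.1
  id_mem := by rintro _ rfl; exact ⟨rfl, rfl, hM.isModelFunction_id, IsCkMap.id _⟩
  comp_mem _ _ _ _ hf _ hg :=
    ⟨hf.1, hg.2.1, hg.2.2.1.comp hf.2.2.1, IsCkMap.comp hg.2.2.2 hf.2.2.2⟩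

theorem isModelSpace_trivCk (C : LinearSpace.{v} 𝕜 σ) : (trivCk k C).IsModelSpace where
  cover := top_unique (le_sSup (Set.mem_univ _))
  inter _ _ _ _ := trivial
  dom_mem _ _ _ _ := trivial
  cod_mem _ _ _ _ := trivial
  id_mem A _ := IsCkMap.id A
  comp_mem _ _ _ _ _ hf hg := IsCkMap.comp hg hf
  continuous _ _ _ hf := IsCkMap.continuous hf
  restrict _ _ _ _ _ _ hA hf _ _ _ h := IsCkMap.of_eq_restrict hf hA h
  inclusion _ _ hA _ _ := IsCkMap.inclusion hA
  sheaf ι U V f hf A B _ _ hAU _ g hg h := by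
    refine IsCkMap.of_locally hg fun x => ?_
    obtain ⟨i, hi⟩ := Opens.mem_iSup.1 (hAU ▸ x.2 : (x : C.toTop) ∈ ⨆ i, U i)
    exact ⟨U i, V i, f i, hi, hf i, fun y hy => h i y hy⟩

/-! ## Maximal m-atlases -/

namespace IsMaximalCkAtlas

variable {T : AtlasTriple.{u, v} 𝕜 σ}

/-- Isomorphisms of the trivial `C^k` model space are by definition `C^k` diffeomorphisms, and every
chart is an m-chart, so both notions of maximal atlas coincide. -/
theorem isMaximalMAtlas_triv (hT : IsMaximalCkAtlas k T) :
    IsMaximalMAtlas (ModelSpace.triv T.E) (trivCk k T.C) T.A :=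
  ⟨⟨fun _ _ => ⟨trivial, trivial, fun _ _ _ => trivial, fun _ _ _ => trivial⟩,
    hT.1.compatible, fun x _ => hT.1.cover x⟩, fun c _ hc => hT.2 c hc⟩

theorem sSup_patches (hT : IsMaximalCkAtlas k T) : sSup {U | ∃ c ∈ T.A, c.U = U} = ⊤ :=
  top_unique fun x _ => by
    obtain ⟨c, hc, hx⟩ := hT.1.cover x
    exact Opens.mem_sSup.2 ⟨c.U, ⟨c, hc, rfl⟩, hx⟩

theorem generated_minTotal (hT : IsMaximalCkAtlas k T) :
    ModelSpace.Generated {U | ∃ c ∈ T.A, c.U = U} (fun A B => {f | TotalGen T A B f})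
      (ModelSpace.triv T.E) where
  isModelSpace := ModelSpace.isModelSpace_triv
  space := hT.sSup_patches.symm
  ob _ _ := trivial
  hom := by
    rintro _ _ _ ⟨c, c', hc, hc', h, t, ht⟩
    rw [ht.eq_trans]
    change Continuous fun y => (⟨_, _⟩ : c'.symm.image c.symm.U)
    refine Continuous.subtype_mk ?_ _
    fun_prop

/-- The competitor that forces morphisms of the minimal model space to be `C^k`. It must be cut down
to the union of the ranges, since this need not be all of `C`. -/
theorem generated_minCoord (hT : IsMaximalCkAtlas k T) :
    ModelSpace.Generated {V | ∃ c ∈ T.A, c.V = V} (fun A B => {f | CoordGen T A B f})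
      ((trivCk k T.C).below (sSup {V | ∃ c ∈ T.A, c.V = V})) where
  isModelSpace := (isModelSpace_trivCk T.C).below trivial
  space := rfl
  ob V hV := ⟨trivial, le_sSup hV⟩
  hom := by
    rintro _ _ _ ⟨c, c', hc, hc', h, t, ht⟩
    rw [ht.eq_trans]
    exact ⟨(hT.isCkDiffeo_trans hc hc').1, (Chart.image_le _ _).trans (le_sSup ⟨c, hc, rfl⟩),
      (Chart.image_le _ _).trans (le_sSup ⟨c', hc', rfl⟩)⟩

theorem mem_minTotal_ob (hT : IsMaximalCkAtlas k T) {c : Chart T.E T.C.toTop} (hc : c ∈ T.A)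
    {U : Opens T.E} (hU : U ≤ c.U) : U ∈ (minTotal T).Ob :=
  ModelSpace.mem_minimal_ob (hT.exists_chart_patch_eq hc hU)

theorem mem_minCoord_ob (hT : IsMaximalCkAtlas k T) {c : Chart T.E T.C.toTop} (hc : c ∈ T.A)
    {V : Opens T.C.toTop} (hV : V ≤ c.V) : V ∈ (minCoord T).Ob :=
  ModelSpace.mem_minimal_ob (hT.exists_chart_range_eq hc hV)

theorem isModelSpace_minTotal (hT : IsMaximalCkAtlas k T) : (minTotal T).IsModelSpace :=
  hT.generated_minTotal.isModelSpace_minimal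

theorem isModelSpace_minCoord (hT : IsMaximalCkAtlas k T) : (minCoord T).IsModelSpace :=
  hT.generated_minCoord.isModelSpace_minimal

theorem isIso_minCoord_trans {c c' : Chart T.E T.C.toTop} (hc : c ∈ T.A) (hc' : c' ∈ T.A)
    (h : ¬ Disjoint c.U c'.U) : (minCoord T).IsIso (c.trans c') :=
  ⟨ModelSpace.mem_minimal_hom (.mk c c' hc hc' h _ (Chart.isTransition_trans c c')),
    ModelSpace.mem_minimal_hom (.mk c' c hc' hc (fun h' => h h'.symm) _
      (Chart.isTransition_trans c' c))⟩

theorem isMaximalMAtlas_min (hT : IsMaximalCkAtlas k T) :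
    IsMaximalMAtlas (minTotal T) (minCoord T) T.A := by
  refine ⟨⟨fun c hc => ⟨hT.mem_minTotal_ob hc le_rfl, hT.mem_minCoord_ob hc le_rfl,
    fun W _ _ => hT.mem_minTotal_ob hc (Chart.image_le _ _),
    fun W _ _ => hT.mem_minCoord_ob hc (Chart.image_le _ _)⟩, fun c hc c' hc' => ?_,
    fun x _ => hT.1.cover x⟩, fun c _ hc => hT.2 c fun c' hc' => ?_⟩
  -- Transition functions are generators only for patches that meet; disjoint patches are
  -- m-compatible anyway.
  · by_cases h : Disjoint c.U c'.U
    · exact Or.inl h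
    · exact Or.inr ⟨_, Chart.isTransition_trans c c', isIso_minCoord_trans hc hc' h⟩
  · refine (hc c' hc').imp_right ?_
    rintro ⟨t, ht, h₁, h₂⟩
    exact ⟨t, ht, (hT.generated_minCoord.minimal_hom _ _ h₁).1,
      (hT.generated_minCoord.minimal_hom _ _ h₂).1⟩

/-- A `C^k` diffeomorphism from a non-void open subset of the range of a chart is an isomorphism of
the minimal model space of the coordinate space. -/
theorem isIso_minCoord_of_isCkDiffeo (hT : IsMaximalCkAtlas k T) {c : Chart T.E T.C.toTop}
    (hc : c ∈ T.A) {V₂ Vh : Opens T.C.toTop} (hV : V₂ ≤ c.V) {e : V₂ ≃ Vh} (he : IsCkDiffeo k e)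
    {x : T.E} (hx : x ∈ c.U) (hx' : (c.φ ⟨x, hx⟩ : T.C.toTop) ∈ V₂) :
    (minCoord T).IsIso e := by
  -- The chart `e ∘ φ` belongs to the atlas, and `e` is the transition to it from `c`. The point `x`
  -- lies in both patches, so this transition is a generator.
  have hd := hT.post_mem hc hV he
  have hxd : x ∈ (c.post hV he.homeomorph).U := Chart.mem_symm_image.2 ⟨hx, hx'⟩
  obtain ⟨h₁, h₂⟩ := isIso_minCoord_trans hc hd
    fun h => (disjoint_iff.1 h ▸ (⟨hx, hxd⟩ : x ∈ c.U ⊓ _) : x ∈ (⊥ : Opens T.E))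
  have hM := hT.isModelSpace_minCoord
  have hV₂ := hT.mem_minCoord_ob hc hV
  have hVh := hT.mem_minCoord_ob hd le_rfl
  have hle : V₂ ≤ c.image (c.post hV he.homeomorph).U := fun y hy =>
    Chart.mem_image.2 ⟨hV hy, Chart.mem_symm_image.2 ⟨(c.φ.symm _).2, by simpa using hy⟩⟩
  have hle' : Vh ≤ (c.post hV he.homeomorph).image c.U := fun y hy =>
    Chart.mem_image.2 ⟨hy, (c.φ.symm _).2⟩
  refine ⟨hM.restrict _ _ _ _ _ _ hle h₁ hV₂ hVh hle' fun y => ?_,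
    hM.restrict _ _ _ _ _ _ hle' h₂ hVh hV₂ hle fun y => ?_⟩
  · exact congrArg (fun z => (e z : T.C.toTop))
      (Subtype.ext (congrArg Subtype.val (c.φ.apply_symm_apply ⟨y, hV y.2⟩)).symm)
  · exact (congrArg Subtype.val (c.φ.apply_symm_apply ⟨e.symm y, hV (e.symm y).2⟩)).symm

end IsMaximalCkAtlas

/-! ## Morphisms -/

namespace IsCkMorphism

variable {T T' : AtlasTriple.{u, v} 𝕜 σ} {f : FunPair T T'}

theorem isMAtlasMorphism_triv (hf : IsCkMorphism k T T' f) :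
    IsMAtlasMorphism (ModelSpace.triv T.E) (trivCk k T.C) T.A
      (ModelSpace.triv T'.E) (trivCk k T'.C) T'.A f.1 f.2 := by
  intro c hc c' hc' x hx hx'
  obtain ⟨U₁, V₁, U₂, V₂, Vh, fh, hfh, H⟩ := hf.nearlyComm c hc c' hc' x hx hx'
  exact ⟨U₁, trivial, V₁, trivial, U₂, trivial, V₂, trivial, Vh, trivial, fh, hfh, H⟩

/-- The data of the `C^k` diagram serve unchanged. Four of the sets lie in patches or ranges of `c`
and `c'`, while `Vh` is the range of the chart obtained from `c'` by `fh`; the image of `x` shows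
that `V₂` is not void. -/
theorem isMAtlasMorphism_min (hT : IsMaximalCkAtlas k T) (hT' : IsMaximalCkAtlas k T')
    (hf : IsCkMorphism k T T' f) :
    IsMAtlasMorphism (minTotal T) (minCoord T) T.A (minTotal T') (minCoord T') T'.A f.1 f.2 := by
  intro c hc c' hc' x hx hx'
  obtain ⟨U₁, V₁, U₂, V₂, Vh, fh, hfh, H⟩ := hf.nearlyComm c hc c' hc' x hx hx'
  exact ⟨U₁, hT.mem_minTotal_ob hc H.U₁_le, V₁, hT.mem_minCoord_ob hc H.V₁_le,
    U₂, hT'.mem_minTotal_ob hc' H.U₂_le, V₂, hT'.mem_minCoord_ob hc' H.V₂_le,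
    Vh, hT'.mem_minCoord_ob (hT'.post_mem hc' H.V₂_le hfh) le_rfl, fh,
    hT'.isIso_minCoord_of_isCkDiffeo hc' H.V₂_le hfh hx'
      (H.φ'_image _ hx' (H.f₀_image x H.x_mem)), H⟩

/-- A point of the coordinate space is the coordinate of some `x`. The diagram at `x` places its
image in `Vh`, which is itself the range of a chart of the target. -/
theorem mem_minCoord_space (hT' : IsMaximalCkAtlas k T')
    (hf : IsCkMorphism k T T' f) {y : T.C.toTop} (hy : y ∈ (minCoord T).S) :
    f.2 y ∈ (minCoord T').S := by
  obtain ⟨_, ⟨c, hc, rfl⟩, hy⟩ := Opens.mem_sSup.1 hy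
  obtain ⟨c', hc', hx'⟩ := hT'.1.cover (f.1 (c.φ.symm ⟨y, hy⟩))
  obtain ⟨U₁, V₁, U₂, V₂, Vh, fh, hfh, H⟩ :=
    hf.nearlyComm c hc c' hc' _ (c.φ.symm ⟨y, hy⟩).2 hx'
  have h := H.fx_mem (c.φ.symm ⟨y, hy⟩).2
  simp only [Subtype.coe_eta, Homeomorph.apply_symm_apply] at h
  exact Opens.mem_sSup.2 ⟨Vh, ⟨_, hT'.post_mem hc' H.V₂_le hfh, rfl⟩, h⟩

theorem mapsSpaces_min (hT' : IsMaximalCkAtlas k T')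
    (hf : IsCkMorphism k T T' f) :
    (∀ x ∈ (minTotal T).S, f.1 x ∈ (minTotal T').S) ∧
      ∀ y ∈ (minCoord T).S, f.2 y ∈ (minCoord T').S :=
  ⟨fun x _ => (hT'.sSup_patches.symm ▸ trivial : f.1 x ∈ sSup {U | ∃ c ∈ T'.A, c.U = U}),
    fun _ hy => hf.mem_minCoord_space hT' hy⟩

/-- The coordinate function, as a function of the trivial model spaces. -/
theorem isCkMap_top (hf : IsCkMorphism k T T' f) :
    IsCkMap k (fun y : (⊤ : Opens T.C.toTop) => (⟨f.2 y, trivial⟩ : (⊤ : Opens T'.C.toTop))) :=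
  IsCk.restrict hf.ck continuous_subtype_val

/-- Manifold morphisms are morphisms of coordinate spaces with trivial model spaces. -/
theorem isLCSMorphism_triv (hf : IsCkMorphism k T T' f) {𝓔 𝓔' : TopSpaceCat.{u}}
    {𝓒 𝓒' : LinSpaceCat.{v} 𝕜 σ}
    (h : IsLCS ⟨T, ⟨𝓔, 𝓒, ModelSpace.triv T.E, trivCk k T.C⟩⟩)
    (h' : IsLCS ⟨T', ⟨𝓔', 𝓒', ModelSpace.triv T'.E, trivCk k T'.C⟩⟩) :
    IsLCSMorphism ⟨T, ⟨𝓔, 𝓒, ModelSpace.triv T.E, trivCk k T.C⟩⟩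
      ⟨T', ⟨𝓔', 𝓒', ModelSpace.triv T'.E, trivCk k T'.C⟩⟩ f where
  isLCS := h
  isLCS' := h'
  maps := ⟨fun _ _ => trivial, fun _ _ => trivial⟩
  modelFun₀ := ModelSpace.isModelFunction_of_continuous (fun _ => Set.mem_univ _)
    (fun _ => Set.mem_univ _)
    ((hf.continuous.comp continuous_subtype_val).subtype_mk _)
  modelFun₁ := ModelSpace.isModelFunction_of_continuous (fun _ => Set.mem_univ _)
    (fun _ => Set.mem_univ _)
    hf.isCkMap_top.continuous
  atlas := hf.isMAtlasMorphism_triv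

end IsCkMorphism

theorem SpaceCat.isFullSubcat_refl {𝔖 : Type w} {P : 𝔖 → TopCat.{u}} (K : SpaceCat P) :
    K.IsFullSubcat K :=
  ⟨⟨subset_rfl, fun _ _ => subset_rfl⟩, fun _ _ _ _ => subset_rfl⟩

theorem SpaceCat.IsSubcat.trans {𝔖 : Type w} {P : 𝔖 → TopCat.{u}} {K L M : SpaceCat P}
    (h : K.IsSubcat L) (h' : L.IsSubcat M) : K.IsSubcat M :=
  ⟨h.1.trans h'.1, fun A B => (h.2 A B).trans (h'.2 A B)⟩

/-! ### Coordinate spaces and morphisms built from manifolds -/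

section Functors

variable {Es : Set TopCat.{u}} {Cs : Set (LinearSpace.{v} 𝕜 σ)} {𝓔 : TopSpaceCat.{u}}
  {𝓒 : LinSpaceCat.{v} 𝕜 σ} {T T' : AtlasTriple.{u, v} 𝕜 σ}

theorem isLCS_dataCk (hT : IsMaximalCkAtlas k T) : IsLCS ((dataCk k).toLCS T) where
  modelCat₀ := SpaceCat.isModelCategory_sing _ ModelSpace.isModelSpace_triv
  modelCat₁ := isModelCategory_singCk _ (isModelSpace_trivCk T.C)
  mem₀ := rfl
  mem₁ := rfl
  maximal := hT.isMaximalMAtlas_triv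

theorem isLCS_dataCkIn (h𝓔 : 𝓔.IsModelCategory) (h𝓒 : 𝓒.IsModelCategory)
    (hE : (trivCat Es).IsSubcat 𝓔) (hC : (trivCatCk k Cs).IsSubcat 𝓒)
    (hT : T ∈ (manCk k Es Cs).Ob) : IsLCS ((dataCkIn k 𝓔 𝓒).toLCS T) where
  modelCat₀ := h𝓔
  modelCat₁ := h𝓒
  mem₀ := hE.1 ⟨T.E, hT.1, rfl⟩
  mem₁ := hC.1 ⟨T.C, hT.2.1, rfl⟩
  maximal := hT.2.2.isMaximalMAtlas_triv

theorem isLCS_dataMin (hT : IsMaximalCkAtlas k T) : IsLCS ((dataMin k).toLCS T) where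
  modelCat₀ := SpaceCat.isModelCategory_sing _ hT.isModelSpace_minTotal
  modelCat₁ := isModelCategory_singCk _ hT.isModelSpace_minCoord
  mem₀ := rfl
  mem₁ := rfl
  maximal := hT.isMaximalMAtlas_min

theorem isLCS_dataMinIn (h𝓔 : 𝓔.IsModelCategory) (h𝓒 : 𝓒.IsModelCategory)
    (hT : IsMaximalCkAtlas k T) (h₀ : topModel (minTotal T) ∈ 𝓔.Ob)
    (h₁ : linModel (minCoord T) ∈ 𝓒.Ob) : IsLCS ((dataMinIn 𝓔 𝓒).toLCS T) where
  modelCat₀ := h𝓔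
  modelCat₁ := h𝓒
  mem₀ := h₀
  mem₁ := h₁
  maximal := hT.isMaximalMAtlas_min

theorem isStrictLCSMorphism_dataCkIn (h𝓔 : 𝓔.IsModelCategory) (h𝓒 : 𝓒.IsModelCategory)
    (hE : (trivCat Es).IsSubcat 𝓔) (hC : (trivCatCk k Cs).IsSubcat 𝓒) {f : FunPair T T'}
    (hf : f ∈ (manCk k Es Cs).Ar T T') :
    IsStrictLCSMorphism ((dataCkIn k 𝓔 𝓒).toLCS T) ((dataCkIn k 𝓔 𝓒).toLCS T') f where
  morphism := hf.2.2.2.2.isLCSMorphism_triv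
    (isLCS_dataCkIn h𝓔 h𝓒 hE hC ((manCk_isCategory k Es Cs).dom_mem _ _ _ hf))
    (isLCS_dataCkIn h𝓔 h𝓒 hE hC ((manCk_isCategory k Es Cs).cod_mem _ _ _ hf))
  full₀ := 𝓔.isFullSubcat_refl
  full₁ := 𝓒.isFullSubcat_refl
  hom₀ := hE.2 _ _ ⟨⟨T.E, hf.1.1, rfl⟩, ⟨T'.E, hf.2.1.1, rfl⟩,
    (hf.2.2.2.2.continuous.comp continuous_subtype_val).subtype_mk _⟩
  hom₁ := hC.2 _ _ ⟨⟨T.C, hf.1.2, rfl⟩, ⟨T'.C, hf.2.1.2, rfl⟩, hf.2.2.2.2.isCkMap_top⟩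

theorem isLCSMorphism_dataMin {f : FunPair T T'} (hf : IsMaximalCkMorphism k T T' f)
    (h : MapsSpaces ((dataMin k).toLCS T) ((dataMin k).toLCS T') f)
    (h₀ : (minTotal T).IsModelFunction (minTotal T') (res₀ h))
    (h₁ : (minCoord T).IsModelFunction (minCoord T') (res₁ h)) :
    IsLCSMorphism ((dataMin k).toLCS T) ((dataMin k).toLCS T') f :=
  ⟨isLCS_dataMin hf.1, isLCS_dataMin hf.2.1, h, h₀, h₁, hf.2.2.isMAtlasMorphism_min hf.1 hf.2.1⟩

/-- The minimal model spaces are objects of the categories as sources and targets of the given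
morphisms, which are model functions because the categories are model categories. -/
theorem isStrictLCSMorphism_dataMinIn (h𝓔 : 𝓔.IsModelCategory) (h𝓒 : 𝓒.IsModelCategory)
    {f : FunPair T T'} (hf : IsMaximalCkMorphism k T T' f)
    (h : MapsSpaces ((dataMinIn 𝓔 𝓒).toLCS T) ((dataMinIn 𝓔 𝓒).toLCS T') f)
    (h₀ : res₀ h ∈ 𝓔.Hom (topModel (minTotal T)) (topModel (minTotal T')))
    (h₁ : res₁ h ∈ 𝓒.Hom (linModel (minCoord T)) (linModel (minCoord T'))) :
    IsStrictLCSMorphism ((dataMinIn 𝓔 𝓒).toLCS T) ((dataMinIn 𝓔 𝓒).toLCS T') f where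
  morphism :=
    ⟨isLCS_dataMinIn h𝓔 h𝓒 hf.1 (h𝓔.dom_mem _ _ _ h₀) (h𝓒.dom_mem _ _ _ h₁),
      isLCS_dataMinIn h𝓔 h𝓒 hf.2.1 (h𝓔.cod_mem _ _ _ h₀) (h𝓒.cod_mem _ _ _ h₁), h,
      h𝓔.isModelFunction _ _ _ h₀, h𝓒.isModelFunction _ _ _ h₁,
      hf.2.2.isMAtlasMorphism_min hf.1 hf.2.1⟩
  full₀ := 𝓔.isFullSubcat_refl
  full₁ := 𝓒.isFullSubcat_refl
  hom₀ := h₀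
  hom₁ := h₁

end Functors

end CkAtlases

end LocalCoord

/-! ### The theorem -/

theorem mainTheorem2 {𝕜 : Type} [RCLike 𝕜] (σ : Setting) (k : WithTop ℕ∞)
    (Es : Set TopCat.{u}) (Cs : Set (LinearSpace.{v} 𝕜 σ))
    (𝓔 𝓔' : TopSpaceCat.{u}) (𝓒 𝓒' : LinSpaceCat.{v} 𝕜 σ)
    (h𝓔 : 𝓔.IsModelCategory) (h𝓔' : 𝓔'.IsModelCategory)
    (h𝓒 : IsCkLinearModelCategory k 𝓒) (h𝓒' : IsCkLinearModelCategory k 𝓒')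
    (hE : (trivCat Es).IsSubcat 𝓔) (hE' : 𝓔.IsSubcat 𝓔')
    (hC : (trivCatCk k Cs).IsSubcat 𝓒) (hC' : 𝓒.IsSubcat 𝓒') :
    -- the four categories and the functors to them
    (∀ D ∈ ({dataCk k, dataCkIn k 𝓔 𝓒, dataMin k, dataMinIn 𝓔' 𝓒'} :
        Set (DataFun.{u, v} 𝕜 σ)),
      (lcsCat k Es Cs D).IsCategory ∧
      (∀ L L', ∀ f ∈ (lcsCat k Es Cs D).Ar L L', MapsSpaces L L' f) ∧
      IsManFunctor k Es Cs D) ∧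
    -- objects: manifolds are sent to local coordinate spaces
    (∀ T ∈ (manCk k Es Cs).Ob,
      IsLCS ((dataCk k).toLCS T) ∧
      IsLCS ((dataCkIn k 𝓔 𝓒).toLCS T) ∧
      IsLCS ((dataCkIn k 𝓔' 𝓒').toLCS T) ∧
      IsLCS ((dataMin k).toLCS T) ∧
      (topModel (minTotal T) ∈ 𝓔'.Ob → linModel (minCoord T) ∈ 𝓒'.Ob →
        IsLCS ((dataMinIn 𝓔' 𝓒').toLCS T))) ∧
    -- arrows: morphisms of manifolds are sent to (strict) morphisms
    (∀ T T', ∀ f ∈ (manCk k Es Cs).Ar T T',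
      IsLCSMorphism ((dataCk k).toLCS T) ((dataCk k).toLCS T') f ∧
      IsLCSMorphism ((dataCk k).toLCS T) ((dataCkIn k 𝓔 𝓒).toLCS T') f ∧
      IsLCSMorphism ((dataCk k).toLCS T) ((dataCkIn k 𝓔' 𝓒').toLCS T') f ∧
      IsStrictLCSMorphism ((dataCkIn k 𝓔 𝓒).toLCS T) ((dataCkIn k 𝓔 𝓒).toLCS T') f ∧
      IsStrictLCSMorphism ((dataCkIn k 𝓔' 𝓒').toLCS T) ((dataCkIn k 𝓔' 𝓒').toLCS T') f ∧
      -- between minimal model spaces, as soon as the restrictions are model functions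
      (∀ h : MapsSpaces ((dataMin k).toLCS T) ((dataMin k).toLCS T') f,
        (minTotal T).IsModelFunction (minTotal T') (res₀ h) →
        (minCoord T).IsModelFunction (minCoord T') (res₁ h) →
        IsLCSMorphism ((dataMin k).toLCS T) ((dataMin k).toLCS T') f) ∧
      (∀ h : MapsSpaces ((dataMinIn 𝓔' 𝓒').toLCS T) ((dataMinIn 𝓔' 𝓒').toLCS T') f,
        res₀ h ∈ 𝓔'.Hom (topModel (minTotal T)) (topModel (minTotal T')) →
        res₁ h ∈ 𝓒'.Hom (linModel (minCoord T)) (linModel (minCoord T')) →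
        IsStrictLCSMorphism ((dataMinIn 𝓔' 𝓒').toLCS T) ((dataMinIn 𝓔' 𝓒').toLCS T') f)) := by
  refine ⟨?_, fun T hT => ⟨isLCS_dataCk hT.2.2,
    isLCS_dataCkIn h𝓔 h𝓒.isModelCategory hE hC hT,
    isLCS_dataCkIn h𝓔' h𝓒'.isModelCategory (hE.trans hE') (hC.trans hC') hT,
    isLCS_dataMin hT.2.2,
    isLCS_dataMinIn h𝓔' h𝓒'.isModelCategory hT.2.2⟩, fun T T' f hf => ?_⟩
  · intro D hD
    refine ⟨lcsCat_isCategory k Es Cs D, ?_, isManFunctor k Es Cs D⟩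
    rintro _ _ _ ⟨T, T', f, -, -, -, hT', hf⟩
    -- Only minimal model spaces require an argument, since the trivial ones have the whole space as
    -- underlying space.
    rcases hD with rfl | rfl | rfl | rfl
    · exact ⟨fun _ _ => trivial, fun _ _ => trivial⟩
    · exact ⟨fun _ _ => trivial, fun _ _ => trivial⟩
    · exact hf.mapsSpaces_min hT'
    · exact hf.mapsSpaces_min hT'
  · have hT := (manCk_isCategory k Es Cs).dom_mem _ _ _ hf
    have hT' := (manCk_isCategory k Es Cs).cod_mem _ _ _ hf
    have hLT := isLCS_dataCk hT.2.2
    have hfk := hf.2.2.2.2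
    exact ⟨hfk.isLCSMorphism_triv hLT (isLCS_dataCk hT'.2.2),
      hfk.isLCSMorphism_triv hLT (isLCS_dataCkIn h𝓔 h𝓒.isModelCategory hE hC hT'),
      hfk.isLCSMorphism_triv hLT
        (isLCS_dataCkIn h𝓔' h𝓒'.isModelCategory (hE.trans hE') (hC.trans hC') hT'),
      isStrictLCSMorphism_dataCkIn h𝓔 h𝓒.isModelCategory hE hC hf,
      isStrictLCSMorphism_dataCkIn h𝓔' h𝓒'.isModelCategory (hE.trans hE') (hC.trans hC') hf,
      isLCSMorphism_dataMin hf.2.2,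
      isStrictLCSMorphism_dataMinIn h𝓔' h𝓒'.isModelCategory hf.2.2⟩
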